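/- Let $\nabla$ be a smooth connection on a smooth real vector bundle $\pi:W\to M$ of finite rank over a smooth finite-dimensional manifold $M$ (without boundary), with curvature tensor $R$. A local section is a smooth section over an open subset of $M$; it is parallel if $\nabla X=0$. For a family $V=(V_x)_{x\in M}$ of linear subspaces $V_x\subseteq W_x$ let $\mathcal S(V)\subseteq V$ be the family of all vectors $v\in V$ for which there is a local section $X$ of $W$ around $\pi(v)$ with values in $V$ and $X(\pi(v))=v$. If $W'$ is a family of subspaces with $\mathcal S(W')=W'$, its second fundamental 1-form $\alpha_{W'}$ sends the value $X(x)$ of a local section $X$ with values in $W'$ to the class of $\nabla X(x)$ in $\mathrm{Hom}(T_xM,W_x/W'_x)$; thus $\ker\alpha_{W'}$ consists of those $w\in W'_x$, $x\in M$, for which there is a local section $X$ around $x$ with values in $W'$, $X(x)=w$ and $\nabla_vX\in W'_x$ for all $v\in T_xM$. Define the derived flag by $$V^{(0)}=\{w\in W: R(\cdot,\cdot)w=0\},\qquad W^{(i)}=\mathcal S(V^{(i)}),\qquad V^{(i+1)}=\ker\alpha_{W^{(i)}}\qquad(i\ge 0).$$ Put $\widetilde W=\bigcap_{i}W^{(i)}$.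 The connection is regular at $x$ if $\widetilde W$ is a smooth vector subbundle of $W$ over some open neighbourhood of $x$, and regular if $\widetilde W$ is a smooth vector subbundle of $W$ over $M$. Theorem. The flag $W^{(0)}\supseteq W^{(1)}\supseteq\cdots$ is descending and terminates: there is $k\in\mathbb N$ with $W^{(l)}=\widetilde W$ for all $l\ge k$. Moreover: (i) If $X:U\subseteq M\to W$ is a local parallel section, then $X(y)\in\widetilde W$ for all $y\in U$. (ii) If $\nabla$ is regular at $x\in M$, then for every $w\in\widetilde W_x$ there is a local parallel section $X:U\to W$ on an open neighbourhood $U$ of $x$, with values in $\widetilde W$, such that $X(x)=w$. (iii) If $\nabla$ is regular, then $(\widetilde W,\nabla)$ is a flat vector bundle over $M$: $\nabla$ restricts to a connection on the subbundle $\widetilde W$, and the curvature of the restriction vanishes. (iv) If $\nabla$ is regular at $x$, then on some open neighbourhood $U$ of $x$ there are $\dim\widetilde W_x$ parallel sections of $W$ that are linearly independent at every point of $U$. (v) Let $\nabla$ be a smooth connection on the tangent bundle $TM$, and let $W$ be the bundle of symmetric covariant two-tensors on $M$ with the induced connection $(\nabla_u g)(A,B)=u(g(A,B))-g(\nabla_uA,B)-g(A,\nabla_uB)$.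 Suppose that this induced connection is regular at $x\in M$. Then $\nabla$ is locally metric at $x$ (that is, some Riemannian metric on an open neighbourhood $U$ of $x$ is parallel) if and only if $\widetilde W_x$ contains a positive-definite bilinear form on $T_xM$. -/

import Mathlib

open Bundle Set FiberBundle
open scoped Manifold ContDiff Topology

set_option linter.unusedSectionVars false

noncomputable section

namespace DerivedFlag

section Flag

variable {E : Type*} [NormedAddCommGroup E] [NormedSpace ℝ E]
  {H : Type*} [TopologicalSpace H] (I : ModelWithCorners ℝ E H)
  {M : Type*} [TopologicalSpace M] [ChartedSpace H M]
  (F : Type*) [NormedAddCommGroup F] [NormedSpace ℝ F]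
  {W : M → Type*} [TopologicalSpace (TotalSpace F W)]
  [∀ x, AddCommGroup (W x)] [∀ x, Module ℝ (W x)]
  [∀ x, TopologicalSpace (W x)]
  [∀ x, IsTopologicalAddGroup (W x)] [∀ x, ContinuousSMul ℝ (W x)]
  [FiberBundle F W] [VectorBundle ℝ F W]

/-- `X` is a smooth section of the vector bundle `W` over the open set `U`
(the values of `X` outside `U` are irrelevant). -/
structure IsLocalSection (X : Π x : M, W x) (U : Set M) : Prop where
  isOpen : IsOpen U
  smooth : ContMDiffOn I (I.prod 𝓘(ℝ, F)) ∞ (fun y ↦ TotalSpace.mk' F y (X y)) U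

variable (W) in
/-- A smooth connection on the vector bundle `W`: a covariant derivative that sends smooth
sections of `W` over an open set `U` to smooth sections of `Hom(TM, W)` over `U`. The covariant
derivative of `X` in the direction `v ∈ T_x M` is written `∇ X x v`. -/
structure Connection [IsManifold I ∞ M] extends CovariantDerivative I F W where
  smooth : ∀ U : Set M, IsOpen U → ContMDiffCovariantDerivativeOn F ∞ toFun U

variable {I F}

/-- The local section `X` over `U` takes its values in the family `V` of subspaces of the fibres. -/
def TakesValuesIn (V : Π x : M, Submodule ℝ (W x)) (X : Π x : M, W x) (U : Set M) : Prop :=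
  ∀ y ∈ U, X y ∈ V y

variable (I F) in
/-- `S(V)`: the vectors of `V` that extend to a smooth local section of `W` with values in `V`. -/
def smoothPart (V : Π x : M, Submodule ℝ (W x)) (x : M) : Submodule ℝ (W x) where
  carrier := {w | ∃ (U : Set M) (X : Π y : M, W y), x ∈ U ∧ IsLocalSection I F X U ∧
    TakesValuesIn V X U ∧ X x = w}
  zero_mem' := ⟨univ, 0, mem_univ x,
    ⟨isOpen_univ, (contMDiff_zeroSection ℝ W).contMDiffOn⟩, fun y _ ↦ (V y).zero_mem, rfl⟩
  add_mem' := by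
    rintro a b ⟨U, X, hxU, hX, hXV, rfl⟩ ⟨U', Y, hxU', hY, hYV, rfl⟩
    exact ⟨U ∩ U', X + Y, ⟨hxU, hxU'⟩, ⟨hX.isOpen.inter hY.isOpen,
      (hX.smooth.mono inter_subset_left).add_section (hY.smooth.mono inter_subset_right)⟩,
      fun y hy ↦ (V y).add_mem (hXV y hy.1) (hYV y hy.2), rfl⟩
  smul_mem' := by
    rintro c a ⟨U, X, hxU, hX, hXV, rfl⟩
    exact ⟨U, c • X, hxU, ⟨hX.isOpen, hX.smooth.const_smul_section⟩,
      fun y hy ↦ (V y).smul_mem c (hXV y hy), rfl⟩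

section

variable [IsManifold I ∞ M]

/-- The section `y ↦ ∇_{Y(y)} X` of `W`. -/
def Connection.deriv (D : Connection I F W) (Y : Π x : M, TangentSpace I x) (X : Π x : M, W x)
    (y : M) : W y :=
  D.toFun X y (Y y)

/-- The curvature tensor
`R(u, v) w = ∇_u ∇_v w - ∇_v ∇_u w - ∇_[u, v] w` at the point `x`, computed with the smooth
extensions of `u`, `v`, `w` to a neighbourhood of `x` that are constant in the preferred local
trivializations at `x`. -/
def Connection.curvature (D : Connection I F W) (x : M) (u v : TangentSpace I x) (w : W x) : W x :=
  D.deriv (extend E u) (D.deriv (extend E v) (extend F w)) x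
    - D.deriv (extend E v) (D.deriv (extend E u) (extend F w)) x
    - D.deriv (VectorField.mlieBracket I (extend E u) (extend E v)) (extend F w) x

lemma IsLocalSection.mdifferentiableAt {X : Π x : M, W x} {U : Set M} {x : M}
    (hX : IsLocalSection I F X U) (hx : x ∈ U) :
    MDifferentiableAt I (I.prod 𝓘(ℝ, F)) (fun y ↦ TotalSpace.mk' F y (X y)) x :=
  (hX.smooth.contMDiffAt (hX.isOpen.mem_nhds hx)).mdifferentiableAt (by simp)

lemma IsLocalSection.add {X X' : Π x : M, W x} {U : Set M}
    (hX : IsLocalSection I F X U) (hX' : IsLocalSection I F X' U) :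
    IsLocalSection I F (X + X') U :=
  ⟨hX.isOpen, hX.smooth.add_section hX'.smooth⟩

lemma IsLocalSection.smul {X : Π x : M, W x} {U : Set M}
    (hX : IsLocalSection I F X U) (c : ℝ) : IsLocalSection I F (c • X) U :=
  ⟨hX.isOpen, hX.smooth.const_smul_section⟩

lemma IsLocalSection.deriv {D : Connection I F W} {U : Set M}
    {Y : Π x : M, TangentSpace I x} {X : Π x : M, W x} (hX : IsLocalSection I F X U)
    (hY : IsLocalSection I E Y U) : IsLocalSection I F (D.deriv Y X) U :=
  ⟨hX.isOpen, ((D.smooth U hX.isOpen).contMDiff (σ := X) (by simpa using hX.smooth)).clm_bundle_apply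
    hY.smooth⟩

lemma Connection.deriv_add (D : Connection I F W) {U : Set M} {x : M} (hx : x ∈ U)
    (Y : Π x : M, TangentSpace I x) {X X' : Π x : M, W x} (hX : IsLocalSection I F X U)
    (hX' : IsLocalSection I F X' U) :
    D.deriv Y (X + X') x = D.deriv Y X x + D.deriv Y X' x := by
  simp [Connection.deriv, D.isCovariantDerivativeOnUniv.add (hX.mdifferentiableAt hx)
    (hX'.mdifferentiableAt hx)]

lemma Connection.deriv_smul (D : Connection I F W) {U : Set M} {x : M} (hx : x ∈ U) (c : ℝ)
    (Y : Π x : M, TangentSpace I x) {X : Π x : M, W x} (hX : IsLocalSection I F X U) :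
    D.deriv Y (c • X) x = c • D.deriv Y X x := by
  simp [Connection.deriv, D.isCovariantDerivativeOnUniv.smul_const c (hX.mdifferentiableAt hx)]

lemma Connection.deriv_congr (D : Connection I F W) {U : Set M} {x : M} (hx : x ∈ U)
    (Y : Π x : M, TangentSpace I x) {X X' : Π x : M, W x} (hX : IsLocalSection I F X U)
    (hX' : IsLocalSection I F X' U) (h : ∀ y ∈ U, X y = X' y) :
    D.deriv Y X x = D.deriv Y X' x := by
  simp [Connection.deriv, D.isCovariantDerivativeOnUniv.mono (subset_univ U)
    |>.congr_of_eqOn (hX.mdifferentiableAt hx) (hX'.mdifferentiableAt hx)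
      (hX.isOpen.mem_nhds hx) h]

lemma extend_add {x y : M} (hy : y ∈ (trivializationAt F W x).baseSet) (a b : W x) :
    (extend F (a + b) y : W y) = extend F a y + extend F b y := by
  have h := (trivializationAt F W x).linear ℝ (mem_baseSet_trivializationAt' (F := F) (E := W) x)
  have hs := Trivialization.symmₗ_apply (R := ℝ) (trivializationAt F W x) hy
  simp only [extend, h.map_add]
  rw [← hs, ← hs, ← hs, map_add]

lemma extend_smul {x y : M} (hy : y ∈ (trivializationAt F W x).baseSet) (c : ℝ) (a : W x) :
    (extend F (c • a) y : W y) = c • extend F a y := by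
  have h := (trivializationAt F W x).linear ℝ (mem_baseSet_trivializationAt' (F := F) (E := W) x)
  have hs := Trivialization.symmₗ_apply (R := ℝ) (trivializationAt F W x) hy
  simp only [extend, h.map_smul]
  rw [← hs, ← hs, map_smul]

lemma isLocalSection_extend [ContMDiffVectorBundle ∞ F W I] {x : M} (w : W x) :
    IsLocalSection I F (extend F w) (trivializationAt F W x).baseSet := by
  set t := trivializationAt F W x with ht
  refine ⟨t.open_baseSet, fun y hy ↦ ?_⟩
  rw [t.contMDiffWithinAt_section _ hy]
  have : ContMDiffOn I 𝓘(ℝ, F) ∞ (fun _ : M ↦ (t ⟨x, w⟩).2) t.baseSet := contMDiffOn_const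
  exact this.congr (fun z hz ↦ by simp [extend, ← ht, hz]) y hy

lemma IsLocalSection.mono {X : Π x : M, W x} {U U' : Set M}
    (hX : IsLocalSection I F X U) (hU' : IsOpen U') (h : U' ⊆ U) : IsLocalSection I F X U' :=
  ⟨hU', hX.smooth.mono h⟩

variable [ContMDiffVectorBundle ∞ F W I]

/-- The curvature tensor is linear in its last argument. -/
def Connection.curvatureLinear (D : Connection I F W) (x : M)
    (u v : TangentSpace I x) : W x →ₗ[ℝ] W x where
  toFun := D.curvature x u v
  map_add' a b := by
    let U := (trivializationAt F W x).baseSet ∩ (trivializationAt E (TangentSpace I) x).baseSet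
    have hU : IsOpen U := (Trivialization.open_baseSet _).inter (Trivialization.open_baseSet _)
    have hx : x ∈ U := ⟨mem_baseSet_trivializationAt' x, mem_baseSet_trivializationAt' x⟩
    have hT (z : TangentSpace I x) : IsLocalSection I E (extend E z) U :=
      (isLocalSection_extend z).mono hU inter_subset_right
    have hW (z : W x) : IsLocalSection I F (extend F z) U :=
      (isLocalSection_extend z).mono hU inter_subset_left
    have key₁ (Y : Π x : M, TangentSpace I x) {y : M} (hy : y ∈ U) :
        D.deriv Y (extend F (a + b)) y = D.deriv Y (extend F a) y + D.deriv Y (extend F b) y := by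
      rw [← D.deriv_add hy Y (hW a) (hW b)]
      exact D.deriv_congr hy Y (hW _) ((hW a).add (hW b)) fun z hz ↦ extend_add hz.1 a b
    have key₂ (Y : Π x : M, TangentSpace I x) (z : TangentSpace I x) :
        D.deriv Y (D.deriv (extend E z) (extend F (a + b))) x =
          D.deriv Y (D.deriv (extend E z) (extend F a)) x
            + D.deriv Y (D.deriv (extend E z) (extend F b)) x := by
      rw [← D.deriv_add hx Y ((hW a).deriv (hT z)) ((hW b).deriv (hT z))]
      exact D.deriv_congr hx Y ((hW _).deriv (hT z))
        (((hW a).deriv (hT z)).add ((hW b).deriv (hT z))) fun y hy ↦ key₁ _ hy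
    simp only [Connection.curvature, key₂, key₁ _ hx]
    abel
  map_smul' c a := by
    let U := (trivializationAt F W x).baseSet ∩ (trivializationAt E (TangentSpace I) x).baseSet
    have hU : IsOpen U := (Trivialization.open_baseSet _).inter (Trivialization.open_baseSet _)
    have hx : x ∈ U := ⟨mem_baseSet_trivializationAt' x, mem_baseSet_trivializationAt' x⟩
    have hT (z : TangentSpace I x) : IsLocalSection I E (extend E z) U :=
      (isLocalSection_extend z).mono hU inter_subset_right
    have hW (z : W x) : IsLocalSection I F (extend F z) U :=
      (isLocalSection_extend z).mono hU inter_subset_left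
    have key₁ (Y : Π x : M, TangentSpace I x) {y : M} (hy : y ∈ U) :
        D.deriv Y (extend F (c • a)) y = c • D.deriv Y (extend F a) y := by
      rw [← D.deriv_smul hy c Y (hW a)]
      exact D.deriv_congr hy Y (hW _) ((hW a).smul c) fun z hz ↦ extend_smul hz.1 c a
    have key₂ (Y : Π x : M, TangentSpace I x) (z : TangentSpace I x) :
        D.deriv Y (D.deriv (extend E z) (extend F (c • a))) x =
          c • D.deriv Y (D.deriv (extend E z) (extend F a)) x := by
      rw [← D.deriv_smul hx c Y ((hW a).deriv (hT z))]
      exact D.deriv_congr hx Y ((hW _).deriv (hT z))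
        (((hW a).deriv (hT z)).smul c) fun y hy ↦ key₁ _ hy
    simp only [Connection.curvature, key₂, key₁ _ hx, RingHom.id_apply, smul_sub]

/-- The kernel of the curvature: all `w` with `R(u, v) w = 0` for all tangent vectors `u`, `v`. -/
def Connection.curvatureKernel (D : Connection I F W) (x : M) : Submodule ℝ (W x) :=
  ⨅ (u : TangentSpace I x) (v : TangentSpace I x), LinearMap.ker (D.curvatureLinear x u v)

/-- The second fundamental 1-form `α_V` of a family `V` of subspaces of the fibres, as a relation
between `w ∈ V_x` and `β ∈ Hom(T_x M, W_x / V_x)`: it sends `X x` to the class of `∇ X x`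
modulo `V_x`, for every smooth local section `X` with values in `V`. Where `V` is a subbundle
this is a linear map; where the dimension of the fibres of `V` jumps it can be multivalued. -/
def Connection.SecondFundamentalForm (D : Connection I F W) (V : Π x : M, Submodule ℝ (W x))
    (x : M) (w : W x) (β : TangentSpace I x →ₗ[ℝ] W x ⧸ V x) : Prop :=
  ∃ (U : Set M) (X : Π y : M, W y), x ∈ U ∧ IsLocalSection I F X U ∧ TakesValuesIn V X U ∧
    X x = w ∧ β = (V x).mkQ ∘ₗ (D.toFun X x).toLinearMap

/-- The kernel of the second fundamental 1-form `α_V`. -/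
def Connection.secondFundamentalKernel (D : Connection I F W) (V : Π x : M, Submodule ℝ (W x))
    (x : M) : Submodule ℝ (W x) where
  carrier := {w | D.SecondFundamentalForm V x w 0}
  zero_mem' := ⟨univ, 0, mem_univ x,
    ⟨isOpen_univ, (contMDiff_zeroSection ℝ W).contMDiffOn⟩, fun y _ ↦ (V y).zero_mem, rfl, by
      ext v
      simp [D.isCovariantDerivativeOnUniv.zero]⟩
  add_mem' := by
    rintro a b ⟨U, X, hxU, hX, hXV, rfl, hX0⟩ ⟨U', Y, hxU', hY, hYV, rfl, hY0⟩
    have hX' := hX.mono (hX.isOpen.inter hY.isOpen) inter_subset_left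
    have hY' := hY.mono (hX.isOpen.inter hY.isOpen) inter_subset_right
    refine ⟨U ∩ U', X + Y, ⟨hxU, hxU'⟩, hX'.add hY',
      fun y hy ↦ (V y).add_mem (hXV y hy.1) (hYV y hy.2), rfl, ?_⟩
    rw [D.isCovariantDerivativeOnUniv.add (hX.mdifferentiableAt hxU) (hY.mdifferentiableAt hxU'),
      ContinuousLinearMap.toLinearMap_add, LinearMap.comp_add, ← hX0, ← hY0, add_zero]
  smul_mem' := by
    rintro c a ⟨U, X, hxU, hX, hXV, rfl, hX0⟩
    refine ⟨U, c • X, hxU, hX.smul c, fun y hy ↦ (V y).smul_mem c (hXV y hy), rfl, ?_⟩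
    rw [D.isCovariantDerivativeOnUniv.smul_const c (hX.mdifferentiableAt hxU),
      ContinuousLinearMap.toLinearMap_smul, LinearMap.comp_smul, ← hX0, smul_zero]

/-- The derived flag `W^(0) ⊇ W^(1) ⊇ ⋯`: `W^(0) = S(ker R)` and `W^(i+1) = S(ker α_{W^(i)})`. -/
def Connection.derivedFlag (D : Connection I F W) : ℕ → Π x : M, Submodule ℝ (W x)
  | 0 => smoothPart I F D.curvatureKernel
  | i + 1 => smoothPart I F (D.secondFundamentalKernel (D.derivedFlag i))

/-- The terminal subset `W̃` of the derived flag. -/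
def Connection.terminal (D : Connection I F W) (x : M) : Submodule ℝ (W x) :=
  ⨅ i : ℕ, D.derivedFlag i x

variable (I F) in
/-- The family `V` is, over the open set `U`, a smooth vector subbundle of `W`: every point of `U`
has an open neighbourhood with a smooth frame of `V`. -/
def IsSubbundleOn (V : Π x : M, Submodule ℝ (W x)) (U : Set M) : Prop :=
  IsOpen U ∧ ∀ x ∈ U, ∃ (n : ℕ) (U' : Set M) (X : Fin n → Π y : M, W y), x ∈ U' ∧
    (∀ i, IsLocalSection I F (X i) U') ∧
    ∀ y ∈ U', LinearIndependent ℝ (fun i ↦ X i y) ∧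
      Submodule.span ℝ (range fun i ↦ X i y) = V y

/-- The connection is regular at `x`: `W̃` is a vector bundle over a neighbourhood of `x`. -/
def Connection.IsRegularAt (D : Connection I F W) (x : M) : Prop :=
  ∃ U : Set M, x ∈ U ∧ IsSubbundleOn I F D.terminal U

/-- The connection is regular: `W̃` is a vector bundle over `M`. -/
def Connection.IsRegular (D : Connection I F W) : Prop :=
  IsSubbundleOn I F D.terminal univ

/-- `X` is a smooth section of `W` over the open set `U` with `∇ X = 0` there. -/
def Connection.IsParallelOn (D : Connection I F W) (X : Π x : M, W x) (U : Set M) : Prop :=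
  IsLocalSection I F X U ∧ ∀ y ∈ U, D.toFun X y = 0

/-- `(V, ∇)` is a flat vector bundle over `M`: `V` is a smooth subbundle of `W`, the connection
restricts to `V`, and the curvature of the restricted connection vanishes. -/
structure Connection.IsFlatSubbundle (D : Connection I F W) (V : Π x : M, Submodule ℝ (W x)) :
    Prop where
  isSubbundle : IsSubbundleOn I F V univ
  deriv_mem : ∀ (U : Set M) (X : Π x : M, W x), IsLocalSection I F X U → TakesValuesIn V X U →
    ∀ y ∈ U, ∀ v : TangentSpace I y, D.toFun X y v ∈ V y
  curvature_eq_zero : ∀ (x : M) (u v : TangentSpace I x), ∀ w ∈ V x, D.curvature x u v w = 0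

end

end Flag

section SymmetricForms

/-- The space of bilinear forms on `E`, with the operator norm. -/
def BilForm (E : Type*) [NormedAddCommGroup E] [NormedSpace ℝ E] : Type _ := E →L[ℝ] E →L[ℝ] ℝ

instance (E : Type*) [NormedAddCommGroup E] [NormedSpace ℝ E] : NormedAddCommGroup (BilForm E) :=
  inferInstanceAs (NormedAddCommGroup (E →L[ℝ] E →L[ℝ] ℝ))

instance (E : Type*) [NormedAddCommGroup E] [NormedSpace ℝ E] : NormedSpace ℝ (BilForm E) :=
  inferInstanceAs (NormedSpace ℝ (E →L[ℝ] E →L[ℝ] ℝ))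

instance (E : Type*) [NormedAddCommGroup E] [NormedSpace ℝ E] [FiniteDimensional ℝ E] :
    FiniteDimensional ℝ (BilForm E) :=
  inferInstanceAs (FiniteDimensional ℝ (E →L[ℝ] E →L[ℝ] ℝ))

/-- The value of a bilinear form. -/
def BilForm.eval {E : Type*} [NormedAddCommGroup E] [NormedSpace ℝ E] (g : BilForm E) (a b : E) :
    ℝ :=
  (show E →L[ℝ] E →L[ℝ] ℝ from g) a b

/-- The space of symmetric bilinear forms on `E`. -/
def SymForm (E : Type*) [NormedAddCommGroup E] [NormedSpace ℝ E] : Submodule ℝ (BilForm E) where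
  carrier := {g | ∀ a b, g.eval a b = g.eval b a}
  zero_mem' := fun _ _ ↦ rfl
  add_mem' := fun hg hh a b ↦ congrArg₂ (· + ·) (hg a b) (hh a b)
  smul_mem' := fun c _ hg a b ↦ congrArg (c * ·) (hg a b)

variable {E : Type*} [NormedAddCommGroup E] [NormedSpace ℝ E] [FiniteDimensional ℝ E]
  {H : Type*} [TopologicalSpace H] {I : ModelWithCorners ℝ E H}
  {M : Type*} [TopologicalSpace M] [ChartedSpace H M]

/-- The pullback `g ↦ g(A ·, A ·)` of symmetric bilinear forms under a linear map `A`. -/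
def SymForm.pullback (A : E →L[ℝ] E) : SymForm E →L[ℝ] SymForm E :=
  LinearMap.toContinuousLinearMap
    { toFun := fun g ↦ ⟨(show E →L[ℝ] E →L[ℝ] ℝ from g.1).bilinearComp A A, fun a b ↦ g.2 (A a) (A b)⟩
      map_add' := fun _ _ ↦ rfl
      map_smul' := fun _ _ ↦ rfl }

@[simp] lemma SymForm.pullback_apply (A : E →L[ℝ] E) (g : SymForm E) (a b : E) :
    (SymForm.pullback A g).1.eval a b = g.1.eval (A a) (A b) := rfl

lemma SymForm.ext {g h : SymForm E} (H : ∀ a b, g.1.eval a b = h.1.eval a b) : g = h :=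
  Subtype.ext (ContinuousLinearMap.ext fun a ↦ ContinuousLinearMap.ext fun b ↦ H a b)

lemma contMDiffAt_clm {G : Type*} [NormedAddCommGroup G] [NormedSpace ℝ G] {n : WithTop ℕ∞}
    {V : Type*} [NormedAddCommGroup V] [NormedSpace ℝ V] [FiniteDimensional ℝ V]
    {f : M → V →L[ℝ] G} {x : M}
    (h : ∀ v, ContMDiffAt I 𝓘(ℝ, G) n (fun y ↦ f y v) x) :
    ContMDiffAt I 𝓘(ℝ, V →L[ℝ] G) n f x := by
  let b := Module.finBasis ℝ V
  have hf : f = fun y ↦ ∑ i, ContinuousLinearMap.smulRightL ℝ V G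
      (LinearMap.toContinuousLinearMap (b.coord i)) (f y (b i)) := by
    funext y
    ext v
    conv_lhs => rw [← b.sum_repr v]
    simp [map_sum, map_smul, -Module.Basis.sum_repr]
  rw [hf]
  exact ContMDiffAt.sum fun i _ ↦
    ((ContinuousLinearMap.smulRightL ℝ V G
      (LinearMap.toContinuousLinearMap (b.coord i))).contMDiff.contMDiffAt).comp x (h (b i))

set_option synthInstance.maxHeartbeats 200000 in
/-- The inclusion of the symmetric bilinear forms into all bilinear forms. -/
def SymForm.toCLM (E : Type*) [NormedAddCommGroup E] [NormedSpace ℝ E] [FiniteDimensional ℝ E] :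
    SymForm E →L[ℝ] (E →L[ℝ] E →L[ℝ] ℝ) :=
  LinearMap.toContinuousLinearMap
    { toFun := fun g ↦ (show E →L[ℝ] E →L[ℝ] ℝ from g.1)
      map_add' := fun _ _ ↦ rfl
      map_smul' := fun _ _ ↦ rfl }

lemma contMDiffAt_symForm {n : WithTop ℕ∞} {f : M → SymForm E} {x : M}
    (h : ∀ a b, ContMDiffAt I 𝓘(ℝ, ℝ) n (fun y ↦ (f y).1.eval a b) x) :
    ContMDiffAt I 𝓘(ℝ, SymForm E) n f x := by
  obtain ⟨p, hp⟩ := LinearMap.exists_leftInverse_of_injective (SymForm E).subtype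
    (Submodule.ker_subtype _)
  let q : BilForm E →L[ℝ] SymForm E := LinearMap.toContinuousLinearMap p
  have h1 : ContMDiffAt I 𝓘(ℝ, BilForm E) n (fun y ↦ (f y).1) x :=
    show ContMDiffAt I 𝓘(ℝ, E →L[ℝ] E →L[ℝ] ℝ) n
      (fun y ↦ (show E →L[ℝ] E →L[ℝ] ℝ from (f y).1)) x from contMDiffAt_clm fun a ↦ contMDiffAt_clm fun b ↦ h a b
  have h2 : f = fun y ↦ q (f y).1 := by
    funext y
    exact (LinearMap.congr_fun hp (f y)).symm
  rw [h2]
  exact q.contMDiff.contMDiffAt.comp x h1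

lemma SymForm.contMDiffOn_pullback {n : WithTop ℕ∞} {s : Set M} (hs : IsOpen s)
    {A : M → E →L[ℝ] E} (hA : ContMDiffOn I 𝓘(ℝ, E →L[ℝ] E) n A s) :
    ContMDiffOn I 𝓘(ℝ, SymForm E →L[ℝ] SymForm E) n (fun y ↦ SymForm.pullback (A y)) s := by
  intro x hx
  have hA' := hA.contMDiffAt (hs.mem_nhds hx)
  refine ContMDiffAt.contMDiffWithinAt (contMDiffAt_clm fun g ↦ contMDiffAt_symForm fun a b ↦ ?_)
  exact ((contMDiffAt_const (c := (show E →L[ℝ] E →L[ℝ] ℝ from g.1))).clm_apply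
    (hA'.clm_apply contMDiffAt_const)).clm_apply
    (hA'.clm_apply contMDiffAt_const)

variable [IsManifold I ∞ M]

variable (I M) in
/-- The cocycle defining the vector bundle of symmetric covariant two-tensors on `M`: its fibre at
`x` is the space of symmetric bilinear forms on `T_x M`, and symmetric bilinear forms are
transported by pullback along the coordinate changes of the tangent bundle. -/
def symCore : VectorBundleCore ℝ M (SymForm E) (atlas H M) where
  baseSet i := i.1.source
  isOpen_baseSet i := i.1.open_source
  indexAt := achart H
  mem_baseSet_at := mem_chart_source H
  coordChange i j x := SymForm.pullback ((tangentBundleCore I M).coordChange j i x)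
  coordChange_self i x hx g := by
    refine SymForm.ext fun a b ↦ ?_
    simp only [SymForm.pullback_apply]
    rw [(tangentBundleCore I M).coordChange_self i x hx, (tangentBundleCore I M).coordChange_self i x hx]
  continuousOn_coordChange i j := by
    have h := ((tangentBundleCore.isContMDiff (I := I) (M := M) (n := ∞) (h := ‹_›)).contMDiffOn_coordChange j i)
    rw [inter_comm] at h
    exact (SymForm.contMDiffOn_pullback (i.1.open_source.inter j.1.open_source) h).continuousOn
  coordChange_comp i j k x hx g := by
    refine SymForm.ext fun a b ↦ ?_
    simp only [SymForm.pullback_apply]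
    have hx' : x ∈ (tangentBundleCore I M).baseSet k ∩ (tangentBundleCore I M).baseSet j ∩
        (tangentBundleCore I M).baseSet i := ⟨⟨hx.2, hx.1.2⟩, hx.1.1⟩
    rw [(tangentBundleCore I M).coordChange_comp k j i x hx',
      (tangentBundleCore I M).coordChange_comp k j i x hx']

instance : (symCore I M).IsContMDiff I ∞ where
  contMDiffOn_coordChange i j := by
    have h := ((tangentBundleCore.isContMDiff (I := I) (M := M) (n := ∞) (h := ‹_›)).contMDiffOn_coordChange j i)
    rw [inter_comm] at h
    exact SymForm.contMDiffOn_pullback (i.1.open_source.inter j.1.open_source) h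

variable (I) in
/-- The vector bundle of symmetric covariant two-tensors on `M`. -/
abbrev SymBundle (x : M) : Type _ := (symCore I M).Fiber x

instance (x : M) : IsTopologicalAddGroup (SymBundle I x) :=
  inferInstanceAs (IsTopologicalAddGroup (SymForm E))

instance (x : M) : ContinuousSMul ℝ (SymBundle I x) :=
  inferInstanceAs (ContinuousSMul ℝ (SymForm E))

/-- A symmetric covariant two-tensor at `x` as a bilinear form on `T_x M`. -/
def SymBundle.toBilin {x : M} (g : SymBundle I x) :
    TangentSpace I x →L[ℝ] TangentSpace I x →L[ℝ] ℝ :=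
  (show SymForm E from g).1

lemma SymBundle.toBilin_symm {x : M} (g : SymBundle I x) (a b : TangentSpace I x) :
    g.toBilin a b = g.toBilin b a :=
  (show SymForm E from g).2 a b

/-- The symmetric covariant two-tensor at `x` given by a symmetric bilinear form on `T_x M`. -/
def SymBundle.mk {x : M} (g : TangentSpace I x →L[ℝ] TangentSpace I x →L[ℝ] ℝ)
    (hg : ∀ a b, g a b = g b a) : SymBundle I x :=
  (show SymForm E from ⟨g, hg⟩)

lemma SymBundle.toBilin_mk {x : M} (g : TangentSpace I x →L[ℝ] TangentSpace I x →L[ℝ] ℝ)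
    (hg : ∀ a b, g a b = g b a) : (SymBundle.mk g hg).toBilin = g := rfl

lemma SymBundle.ext {x : M} {g h : SymBundle I x} (H : ∀ a b, g.toBilin a b = h.toBilin a b) :
    g = h :=
  SymForm.ext H

lemma SymBundle.toBilin_add {x : M} (g h : SymBundle I x) (a b : TangentSpace I x) :
    (g + h).toBilin a b = g.toBilin a b + h.toBilin a b := rfl

lemma SymBundle.toBilin_smul {x : M} (c : ℝ) (g : SymBundle I x) (a b : TangentSpace I x) :
    (c • g).toBilin a b = c * g.toBilin a b := rfl

lemma SymBundle.toBilin_eq {x₀ x : M} (hx : x ∈ (chartAt H x₀).source) (g : SymBundle I x)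
    (a b : TangentSpace I x) :
    g.toBilin a b = (trivializationAt (SymForm E) (SymBundle I) x₀ ⟨x, g⟩).2.1.eval
      (trivializationAt E (TangentSpace I) x₀ ⟨x, a⟩).2
      (trivializationAt E (TangentSpace I) x₀ ⟨x, b⟩).2 := by
  have h (v : E) : (tangentBundleCore I M).coordChange (achart H x₀) (achart H x) x
      ((tangentBundleCore I M).coordChange (achart H x) (achart H x₀) x v) = v := by
    rw [(tangentBundleCore I M).coordChange_comp (achart H x) (achart H x₀) (achart H x) x
      ⟨⟨mem_chart_source H x, hx⟩, mem_chart_source H x⟩]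
    exact (tangentBundleCore I M).coordChange_self (achart H x) x (mem_chart_source H x) v
  change _ = (show SymForm E from g).1.eval _ _
  erw [h, h]
  rfl

set_option synthInstance.maxHeartbeats 200000 in
lemma SymBundle.mdifferentiableAt {g : Π x : M, SymBundle I x} {A B : Π x : M, TangentSpace I x}
    {x : M}
    (hg : MDifferentiableAt I (I.prod 𝓘(ℝ, SymForm E))
      (fun y ↦ TotalSpace.mk' (SymForm E) y (g y)) x)
    (hA : MDifferentiableAt I (I.prod 𝓘(ℝ, E)) (fun y ↦ TotalSpace.mk' E y (A y)) x)
    (hB : MDifferentiableAt I (I.prod 𝓘(ℝ, E)) (fun y ↦ TotalSpace.mk' E y (B y)) x) :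
    MDifferentiableAt I 𝓘(ℝ, ℝ) (fun y ↦ (g y).toBilin (A y) (B y)) x := by
  rw [mdifferentiableAt_section] at hg hA hB
  have h := ((((SymForm.toCLM E).contMDiff (n := 1)).mdifferentiable one_ne_zero _).comp x hg
    |>.clm_apply hA).clm_apply hB
  refine h.congr_of_eventuallyEq ?_
  filter_upwards [(chartAt H x).open_source.mem_nhds (mem_chart_source H x)] with y hy
  exact SymBundle.toBilin_eq hy _ _ _

set_option synthInstance.maxHeartbeats 200000 in
lemma SymBundle.contMDiffAt {n : ℕ∞} {g : Π x : M, SymBundle I x} {A B : Π x : M, TangentSpace I x}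
    {x : M}
    (hg : ContMDiffAt I (I.prod 𝓘(ℝ, SymForm E)) n
      (fun y ↦ TotalSpace.mk' (SymForm E) y (g y)) x)
    (hA : ContMDiffAt I (I.prod 𝓘(ℝ, E)) n (fun y ↦ TotalSpace.mk' E y (A y)) x)
    (hB : ContMDiffAt I (I.prod 𝓘(ℝ, E)) n (fun y ↦ TotalSpace.mk' E y (B y)) x) :
    ContMDiffAt I 𝓘(ℝ, ℝ) n (fun y ↦ (g y).toBilin (A y) (B y)) x := by
  rw [contMDiffAt_section] at hg hA hB
  have h := (((SymForm.toCLM E).contMDiff.contMDiffAt.comp x hg).clm_apply hA).clm_apply hB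
  refine h.congr_of_eventuallyEq ?_
  filter_upwards [(chartAt H x).open_source.mem_nhds (mem_chart_source H x)] with y hy
  exact SymBundle.toBilin_eq hy _ _ _

/-- For sections `A`, `B` of `TM`, the 1-form
`u ↦ u(g(A, B)) - g(∇_u A, B) - g(A, ∇_u B)` at `x`. -/
def Connection.symAux (C : Connection I E (TangentSpace I : M → Type _))
    (g : Π x : M, SymBundle I x) (x : M) (A B : Π x : M, TangentSpace I x) :
    TangentSpace I x →L[ℝ] ℝ :=
  mvfderiv I (fun y ↦ (g y).toBilin (A y) (B y)) x
    - ((g x).toBilin (B x)) ∘L (C.toFun A x) - ((g x).toBilin (A x)) ∘L (C.toFun B x)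

lemma Connection.symAux_tensorial₁ (C : Connection I E (TangentSpace I : M → Type _))
    (g : Π x : M, SymBundle I x) (x : M)
    (hg : MDifferentiableAt I (I.prod 𝓘(ℝ, SymForm E))
      (fun y ↦ TotalSpace.mk' (SymForm E) y (g y)) x) (B : Π x : M, TangentSpace I x)
    (hB : MDifferentiableAt I (I.prod 𝓘(ℝ, E)) (fun y ↦ TotalSpace.mk' E y (B y)) x) :
    TensorialAt I E (C.symAux g x · B) x where
  smul {f A} hf hA := by
    have h1 : mvfderiv I (fun y ↦ (g y).toBilin ((f • A) y) (B y)) x =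
        f x • mvfderiv I (fun y ↦ (g y).toBilin (A y) (B y)) x +
          (g x).toBilin (A x) (B x) • mvfderiv I f x := by
      rw [← mvfderiv_mul hf (SymBundle.mdifferentiableAt hg hA hB)]
      congr 1
      funext y
      simp
    have h2 := C.isCovariantDerivativeOnUniv.leibniz hA hf
    ext u
    simp only [Connection.symAux, h1, h2]
    simp [SymBundle.toBilin_symm (g x) (B x) (A x)]
    ring
  add {A A'} hA hA' := by
    have h1 : mvfderiv I (fun y ↦ (g y).toBilin ((A + A') y) (B y)) x =
        mvfderiv I (fun y ↦ (g y).toBilin (A y) (B y)) x +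
          mvfderiv I (fun y ↦ (g y).toBilin (A' y) (B y)) x := by
      rw [← mvfderiv_add (SymBundle.mdifferentiableAt hg hA hB)
        (SymBundle.mdifferentiableAt hg hA' hB)]
      congr 1
      funext y
      simp
    have h2 := C.isCovariantDerivativeOnUniv.add hA hA'
    ext u
    simp only [Connection.symAux, h1, h2]
    simp [SymBundle.toBilin_symm (g x) (B x) (A x)]
    ring

lemma Connection.symAux_comm (C : Connection I E (TangentSpace I : M → Type _))
    (g : Π x : M, SymBundle I x) (x : M) (A B : Π x : M, TangentSpace I x) :
    C.symAux g x A B = C.symAux g x B A := by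
  have h : (fun y ↦ (g y).toBilin (A y) (B y)) = fun y ↦ (g y).toBilin (B y) (A y) :=
    funext fun y ↦ (g y).toBilin_symm _ _
  simp only [Connection.symAux, h]
  abel

lemma Connection.symAux_apply_tensorial (C : Connection I E (TangentSpace I : M → Type _))
    (g : Π x : M, SymBundle I x) (x : M) (u : TangentSpace I x)
    (hg : MDifferentiableAt I (I.prod 𝓘(ℝ, SymForm E))
      (fun y ↦ TotalSpace.mk' (SymForm E) y (g y)) x) (B : Π x : M, TangentSpace I x)
    (hB : MDifferentiableAt I (I.prod 𝓘(ℝ, E)) (fun y ↦ TotalSpace.mk' E y (B y)) x) :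
    TensorialAt I E (fun A ↦ C.symAux g x A B u) x where
  smul hf hA := by
    simp only [(C.symAux_tensorial₁ g x hg B hB).smul hf hA, _root_.smul_apply]
  add hA hA' := by
    simp only [(C.symAux_tensorial₁ g x hg B hB).add hA hA', _root_.add_apply]

lemma Connection.symAux_apply_tensorial' (C : Connection I E (TangentSpace I : M → Type _))
    (g : Π x : M, SymBundle I x) (x : M) (u : TangentSpace I x)
    (hg : MDifferentiableAt I (I.prod 𝓘(ℝ, SymForm E))
      (fun y ↦ TotalSpace.mk' (SymForm E) y (g y)) x) (B : Π x : M, TangentSpace I x)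
    (hB : MDifferentiableAt I (I.prod 𝓘(ℝ, E)) (fun y ↦ TotalSpace.mk' E y (B y)) x) :
    TensorialAt I E (fun A ↦ C.symAux g x B A u) x := by
  simpa only [C.symAux_comm g x B] using C.symAux_apply_tensorial g x u hg B hB

/-- The symmetric bilinear form `∇_u g` on `T_x M`, for a section `g` differentiable at `x`. -/
def Connection.symDerivAt (C : Connection I E (TangentSpace I : M → Type _))
    (g : Π x : M, SymBundle I x) (x : M)
    (hg : MDifferentiableAt I (I.prod 𝓘(ℝ, SymForm E))
      (fun y ↦ TotalSpace.mk' (SymForm E) y (g y)) x) (u : TangentSpace I x) : SymBundle I x :=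
  SymBundle.mk (TensorialAt.mkHom₂ (fun A B ↦ C.symAux g x A B u) x
      (C.symAux_apply_tensorial g x u hg) (C.symAux_apply_tensorial' g x u hg))
    fun a b ↦ by
      rw [TensorialAt.mkHom₂_apply_eq_extend, TensorialAt.mkHom₂_apply_eq_extend, C.symAux_comm]

lemma Connection.symDerivAt_extend (C : Connection I E (TangentSpace I : M → Type _))
    (g : Π x : M, SymBundle I x) (x : M)
    (hg : MDifferentiableAt I (I.prod 𝓘(ℝ, SymForm E))
      (fun y ↦ TotalSpace.mk' (SymForm E) y (g y)) x) (u a b : TangentSpace I x) :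
    (C.symDerivAt g x hg u).toBilin a b = C.symAux g x (extend E a) (extend E b) u := rfl

lemma Connection.symDerivAt_apply (C : Connection I E (TangentSpace I : M → Type _))
    (g : Π x : M, SymBundle I x) (x : M)
    (hg : MDifferentiableAt I (I.prod 𝓘(ℝ, SymForm E))
      (fun y ↦ TotalSpace.mk' (SymForm E) y (g y)) x) (u : TangentSpace I x)
    {A B : Π x : M, TangentSpace I x}
    (hA : MDifferentiableAt I (I.prod 𝓘(ℝ, E)) (fun y ↦ TotalSpace.mk' E y (A y)) x)
    (hB : MDifferentiableAt I (I.prod 𝓘(ℝ, E)) (fun y ↦ TotalSpace.mk' E y (B y)) x) :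
    (C.symDerivAt g x hg u).toBilin (A x) (B x) = C.symAux g x A B u :=
  TensorialAt.mkHom₂_apply (C.symAux_apply_tensorial g x u hg)
    (C.symAux_apply_tensorial' g x u hg) hA hB

open Classical in
/-- The covariant derivative `u ↦ ∇_u g` at `x` of a symmetric covariant two-tensor, that is
`(∇_u g)(A, B) = u(g(A, B)) - g(∇_u A, B) - g(A, ∇_u B)` for all vector fields `A`, `B`
(and zero by convention if `g` is not differentiable at `x`). -/
def Connection.symDeriv (C : Connection I E (TangentSpace I : M → Type _))
    (g : Π x : M, SymBundle I x) (x : M) : TangentSpace I x →L[ℝ] SymBundle I x :=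
  if hg : MDifferentiableAt I (I.prod 𝓘(ℝ, SymForm E))
      (fun y ↦ TotalSpace.mk' (SymForm E) y (g y)) x then
    haveI : FiniteDimensional ℝ (TangentSpace I x) := inferInstanceAs (FiniteDimensional ℝ E)
    haveI : T2Space (TangentSpace I x) := inferInstanceAs (T2Space E)
    LinearMap.toContinuousLinearMap
      { toFun := C.symDerivAt g x hg
        map_add' := fun u v ↦ SymBundle.ext fun a b ↦ by
          simp [SymBundle.toBilin_add, C.symDerivAt_extend]
        map_smul' := fun c u ↦ SymBundle.ext fun a b ↦ by
          simp [SymBundle.toBilin_smul, C.symDerivAt_extend] }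
  else 0

lemma Connection.symDeriv_apply (C : Connection I E (TangentSpace I : M → Type _))
    {g : Π x : M, SymBundle I x} {x : M}
    (hg : MDifferentiableAt I (I.prod 𝓘(ℝ, SymForm E))
      (fun y ↦ TotalSpace.mk' (SymForm E) y (g y)) x) (u : TangentSpace I x)
    {A B : Π x : M, TangentSpace I x}
    (hA : MDifferentiableAt I (I.prod 𝓘(ℝ, E)) (fun y ↦ TotalSpace.mk' E y (A y)) x)
    (hB : MDifferentiableAt I (I.prod 𝓘(ℝ, E)) (fun y ↦ TotalSpace.mk' E y (B y)) x) :
    (C.symDeriv g x u).toBilin (A x) (B x) =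
      mvfderiv I (fun y ↦ (g y).toBilin (A y) (B y)) x u
        - (g x).toBilin (C.toFun A x u) (B x) - (g x).toBilin (A x) (C.toFun B x u) := by
  have h : C.symDeriv g x u = C.symDerivAt g x hg u := by
    simp only [Connection.symDeriv, dif_pos hg]
    rfl
  rw [h, C.symDerivAt_apply g x hg u hA hB, (g x).toBilin_symm (C.toFun A x u)]
  rfl

lemma Connection.symDeriv_isCovariantDerivativeOn
    (C : Connection I E (TangentSpace I : M → Type _)) :
    IsCovariantDerivativeOn (SymForm E) (I := I) (V := SymBundle I (M := M)) C.symDeriv where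
  add {g g' x} hg hg' _ := by
    ext u
    refine SymBundle.ext fun a b ↦ ?_
    have ha : MDifferentiableAt I (I.prod 𝓘(ℝ, E)) (fun y ↦ TotalSpace.mk' E y (extend E a y)) x :=
      mdifferentiableAt_extend ..
    have hb : MDifferentiableAt I (I.prod 𝓘(ℝ, E)) (fun y ↦ TotalSpace.mk' E y (extend E b y)) x :=
      mdifferentiableAt_extend ..
    have h := C.symDeriv_apply hg u ha hb
    have h' := C.symDeriv_apply hg' u ha hb
    have h'' := C.symDeriv_apply (mdifferentiableAt_add_section hg hg') u ha hb
    have h1 : mvfderiv I (fun y ↦ ((g + g') y).toBilin (extend E a y) (extend E b y)) x =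
        mvfderiv I (fun y ↦ (g y).toBilin (extend E a y) (extend E b y)) x +
          mvfderiv I (fun y ↦ (g' y).toBilin (extend E a y) (extend E b y)) x := by
      rw [← mvfderiv_add (SymBundle.mdifferentiableAt hg ha hb)
        (SymBundle.mdifferentiableAt hg' ha hb)]
      rfl
    rw [h1] at h''
    simp only [extend_apply_self] at h h' h''
    change _ = (C.symDeriv g x u + C.symDeriv g' x u).toBilin a b
    rw [h'', SymBundle.toBilin_add, h, h']
    simp only [Pi.add_apply, SymBundle.toBilin_add, _root_.add_apply]
    ring
  leibniz {g f x} hg hf _ := by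
    ext u
    refine SymBundle.ext fun a b ↦ ?_
    have ha : MDifferentiableAt I (I.prod 𝓘(ℝ, E)) (fun y ↦ TotalSpace.mk' E y (extend E a y)) x :=
      mdifferentiableAt_extend ..
    have hb : MDifferentiableAt I (I.prod 𝓘(ℝ, E)) (fun y ↦ TotalSpace.mk' E y (extend E b y)) x :=
      mdifferentiableAt_extend ..
    have h := C.symDeriv_apply hg u ha hb
    have h'' := C.symDeriv_apply (hf.smul_section hg) u ha hb
    have h1 : mvfderiv I (fun y ↦ ((f • g) y).toBilin (extend E a y) (extend E b y)) x =
        f x • mvfderiv I (fun y ↦ (g y).toBilin (extend E a y) (extend E b y)) x +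
          (g x).toBilin (extend E a x) (extend E b x) • mvfderiv I f x := by
      rw [← mvfderiv_mul hf (SymBundle.mdifferentiableAt hg ha hb)]
      rfl
    rw [h1] at h''
    simp only [extend_apply_self] at h h''
    change _ = (f x • C.symDeriv g x u + mvfderiv I f x u • g x).toBilin a b
    have h3 (v w : TangentSpace I x) :
        SymBundle.toBilin ((f • g) x) v w = f x * (g x).toBilin v w := rfl
    rw [h'', SymBundle.toBilin_add, SymBundle.toBilin_smul, SymBundle.toBilin_smul, h, h3, h3]
    simp only [_root_.add_apply, _root_.smul_apply, smul_eq_mul]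
    ring

lemma contMDiffOn_mvfderiv_apply {p : M → ℝ} {A : Π x : M, TangentSpace I x} {U : Set M}
    (hp : ContMDiffOn I 𝓘(ℝ, ℝ) ∞ p U) (hA : IsLocalSection I E A U) :
    ContMDiffOn I 𝓘(ℝ, ℝ) ∞ (fun x ↦ mvfderiv I p x (A x)) U := by
  have h1 := hp.contMDiffOn_tangentMapWithin (m := ∞) (by simp) hA.isOpen.uniqueMDiffOn
  have h2 := h1.comp hA.smooth (fun x hx ↦ hx)
  have h3 := (contMDiff_snd_tangentBundle_modelSpace ℝ 𝓘(ℝ, ℝ) (n := ∞)).contMDiffOn (s := univ)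
    |>.comp h2 (fun _ _ ↦ mem_univ _)
  refine h3.congr fun x hx ↦ ?_
  change mfderiv I 𝓘(ℝ, ℝ) p x (A x) = mfderivWithin I 𝓘(ℝ, ℝ) p U x (A x)
  rw [mfderivWithin_of_isOpen hA.isOpen hx]

lemma Connection.symDeriv_smooth (C : Connection I E (TangentSpace I : M → Type _)) (U : Set M)
    (hU : IsOpen U) :
    ContMDiffCovariantDerivativeOn (SymForm E) (I := I) (V := SymBundle I (M := M)) ∞
      C.symDeriv U where
  contMDiff {g} hg := by
    have hg' : IsLocalSection I (SymForm E) g U := ⟨hU, by simpa using hg⟩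
    intro x₀ hx₀
    refine ContMDiffAt.contMDiffWithinAt ?_
    rw [contMDiffAt_hom_bundle]
    refine ⟨contMDiffAt_id, contMDiffAt_clm fun u ↦ contMDiffAt_symForm fun a b ↦ ?_⟩
    let e := trivializationAt E (TangentSpace I : M → Type _) x₀
    let S (v : E) (y : M) : TangentSpace I y := e.symm y v
    let N := U ∩ e.baseSet
    have hN : IsOpen N := hU.inter e.open_baseSet
    have hx₀N : x₀ ∈ N := ⟨hx₀, mem_baseSet_trivializationAt' x₀⟩
    have hS (v : E) : IsLocalSection I E (S v) N := by
      refine ⟨hN, fun y hy ↦ ?_⟩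
      rw [e.contMDiffWithinAt_section _ hy.2]
      exact (contMDiffOn_const (c := v)).congr
        (fun z (hz : z ∈ N) ↦ by simp [S, hz.2]) y hy
    have hgN : IsLocalSection I (SymForm E) g N := hg'.mono hN inter_subset_left
    have pair {A B : Π x : M, TangentSpace I x} (hA : IsLocalSection I E A N)
        (hB : IsLocalSection I E B N) :
        ContMDiffOn I 𝓘(ℝ, ℝ) ∞ (fun y ↦ (g y).toBilin (A y) (B y)) N := fun y hy ↦
      (SymBundle.contMDiffAt (n := ⊤) (hgN.smooth.contMDiffAt (hN.mem_nhds hy))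
        (hA.smooth.contMDiffAt (hN.mem_nhds hy))
        (hB.smooth.contMDiffAt (hN.mem_nhds hy))).contMDiffWithinAt
    have main : ContMDiffOn I 𝓘(ℝ, ℝ) ∞ (fun y ↦
        mvfderiv I (fun y ↦ (g y).toBilin (S a y) (S b y)) y (S u y)
        - (g y).toBilin (C.deriv (S u) (S a) y) (S b y)
        - (g y).toBilin (S a y) (C.deriv (S u) (S b) y)) N :=
      ((contMDiffOn_mvfderiv_apply (pair (hS a) (hS b)) (hS u)).sub
        (pair ((hS a).deriv (hS u)) (hS b))).sub (pair (hS a) ((hS b).deriv (hS u)))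
    refine (main.contMDiffAt (hN.mem_nhds hx₀N)).congr_of_eventuallyEq ?_
    filter_upwards [hN.mem_nhds hx₀N] with y hy
    have hy' : y ∈ (trivializationAt (SymForm E) (SymBundle I) x₀).baseSet := hy.2
    have hv (v : E) : (trivializationAt E (TangentSpace I) x₀ ⟨y, S v y⟩).2 = v := by
      change (e ⟨y, e.symm y v⟩).2 = v
      simp [hy.2]
    have key := C.symDeriv_apply (hgN.mdifferentiableAt hy) (S u y) ((hS a).mdifferentiableAt hy)
      ((hS b).mdifferentiableAt hy)
    rw [SymBundle.toBilin_eq (x₀ := x₀) hy.2, hv, hv] at key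
    refine Eq.trans ?_ key
    rw [ContinuousLinearMap.inCoordinates_eq hy.2 hy']
    simp only [ContinuousLinearMap.comp_apply]
    have h1 (w : SymBundle I y) : (trivializationAt (SymForm E) (SymBundle I) x₀).continuousLinearEquivAt ℝ y hy' w =
        (trivializationAt (SymForm E) (SymBundle I) x₀ ⟨y, w⟩).2 := by
      rw [Trivialization.coe_continuousLinearEquivAt_eq _ hy']
      exact congrFun (Trivialization.coe_linearMapAt_of_mem (R := ℝ) _ hy') w
    refine (congrArg (fun q : SymForm E ↦ q.1.eval a b) (h1 _)).trans ?_
    rfl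

/-- The connection on the bundle of symmetric covariant two-tensors induced by a connection on
`TM`. -/
def Connection.onSymForms (C : Connection I E (TangentSpace I : M → Type _)) :
    Connection I (SymForm E) (SymBundle I (M := M)) where
  toFun := C.symDeriv
  isCovariantDerivativeOnUniv := C.symDeriv_isCovariantDerivativeOn
  smooth := C.symDeriv_smooth

/-- A symmetric covariant two-tensor at a point is positive definite. -/
def SymBundle.IsPosDef {x : M} (g : SymBundle I x) : Prop :=
  ∀ v : TangentSpace I x, v ≠ 0 → 0 < g.toBilin v v

/-- A connection on `TM` is locally metric at `x` if some Riemannian metric on a neighbourhood of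
`x` is parallel. -/
def Connection.IsLocallyMetricAt (C : Connection I E (TangentSpace I : M → Type _)) (x : M) :
    Prop :=
  ∃ (U : Set M) (g : Π x : M, SymBundle I x),
    x ∈ U ∧ C.onSymForms.IsParallelOn g U ∧ ∀ y ∈ U, (g y).IsPosDef

end SymmetricForms

end DerivedFlag
end

noncomputable section

namespace DerivedFlag

set_option maxSynthPendingDepth 3

section TotalDifferentialEquations

variable {E : Type*} [NormedAddCommGroup E] [NormedSpace ℝ E]
  {G : Type*} [NormedAddCommGroup G] [NormedSpace ℝ G]

open Metric in
/-- Linear ordinary differential equations with small coefficients have solutions on `[0, 1]`. -/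
lemma exists_linearODE_solution [CompleteSpace G] {B : ℝ → G →L[ℝ] G}
    (hB : ContinuousOn B (Icc 0 1)) (hB' : ∀ t ∈ Icc (0 : ℝ) 1, ‖B t‖ ≤ 1 / 2) (c : G) :
    ∃ g : ℝ → G, g 0 = c ∧
      ∀ t ∈ Icc (0 : ℝ) 1, HasDerivWithinAt g (-B t (g t)) (Icc 0 1) t := by
  let t₀ : Icc (0 : ℝ) 1 := ⟨0, by simp⟩
  have hP : IsPicardLindelof (fun t x ↦ -B t x) t₀ c (‖c‖₊ + 1) 0 (‖c‖₊ + 1) 1 := by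
    refine ⟨fun t ht ↦ ?_, fun x _ ↦ ?_, fun t ht x hx ↦ ?_, ?_⟩
    · refine LipschitzOnWith.of_dist_le_mul fun x _ y _ ↦ ?_
      rw [dist_eq_norm, dist_eq_norm, neg_sub_neg, ← map_sub, norm_sub_rev x y]
      refine ((B t).le_opNorm _).trans ?_
      have := hB' t ht
      gcongr
      exact this.trans (by norm_num)
    · exact (hB.clm_apply continuousOn_const).neg
    · rw [norm_neg]
      refine ((B t).le_opNorm _).trans ?_
      have h1 := hB' t ht
      have h2 : ‖x‖ ≤ ‖c‖ + (‖c‖ + 1) := by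
        have := norm_le_norm_add_norm_sub' x c
        rw [mem_closedBall, dist_eq_norm] at hx
        simp only [NNReal.coe_add, coe_nnnorm, NNReal.coe_one] at hx
        linarith
      simp only [NNReal.coe_add, coe_nnnorm, NNReal.coe_one]
      nlinarith [norm_nonneg x, norm_nonneg (B t)]
    · simp [t₀]
  exact hP.exists_eq_forall_mem_Icc_hasDerivWithinAt₀

/-- Solutions of a linear total differential equation `df = -A f` with smooth coefficients are
smooth. -/
lemma contDiffOn_of_hasFDerivAt_clm {A : E → E →L[ℝ] G →L[ℝ] G} {O : Set E} (hO : IsOpen O)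
    (hA : ContDiffOn ℝ ∞ A O) {f : E → G}
    (hf : ∀ p ∈ O, HasFDerivAt f (-(A p).flip (f p)) p) : ContDiffOn ℝ ∞ f O := by
  refine contDiffOn_infty.2 fun n ↦ ?_
  induction n with
  | zero =>
    exact contDiffOn_zero.2 fun p hp ↦ (hf p hp).continuousAt.continuousWithinAt
  | succ n ih =>
    rw [Nat.cast_succ, contDiffOn_succ_iff_fderiv_of_isOpen hO]
    refine ⟨fun p hp ↦ (hf p hp).differentiableAt.differentiableWithinAt, by simp, ?_⟩
    have h0 : ContDiffOn ℝ n (fun p ↦ (A p).flip) O :=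
      (ContinuousLinearMap.flipₗᵢ ℝ E G G).toContinuousLinearEquiv.contDiff.comp_contDiffOn
        (hA.of_le (by norm_cast; exact le_top))
    have h1 : ContDiffOn ℝ n (fun p ↦ -(A p).flip (f p)) O := (h0.clm_apply ih).neg
    exact h1.congr fun p hp ↦ (hf p hp).fderiv

/-- The first-order Taylor estimate for a map whose derivative is Lipschitz. -/
lemma norm_sub_sub_fderiv_le {F : Type*} [NormedAddCommGroup F] [NormedSpace ℝ F] {A : E → F}
    {s : Set E} (hs : Convex ℝ s) {K : NNReal} (hA : ∀ p ∈ s, DifferentiableAt ℝ A p)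
    (hK : LipschitzOnWith K (fderiv ℝ A) s) {p q : E} (hp : p ∈ s) (hq : q ∈ s) :
    ‖A q - A p - fderiv ℝ A p (q - p)‖ ≤ K * ‖q - p‖ ^ 2 := by
  have hseg : segment ℝ p q ⊆ s := hs.segment_subset hp hq
  have h := (convex_segment p q).norm_image_sub_le_of_norm_hasFDerivWithin_le'
    (f := A) (f' := fderiv ℝ A) (φ := fderiv ℝ A p) (C := K * ‖q - p‖)
    (fun z hz ↦ (hA z (hseg hz)).hasFDerivAt.hasFDerivWithinAt) (fun z hz ↦ ?_)
    (left_mem_segment ℝ p q) (right_mem_segment ℝ p q)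
  · refine h.trans_eq (by ring)
  · refine (hK.norm_sub_le (hseg hz) hp).trans ?_
    gcongr
    exact norm_sub_le_of_mem_segment hz

/-- How the solution of the radial equation `g' = -A(p₀ + ty)(y) g` depends on `y`, for a flat
connection form `A`. -/
lemma norm_radialSolution_sub_le {A : E → E →L[ℝ] G →L[ℝ] G} {p₀ : E} {s : Set E}
    (hs : Convex ℝ s) {K₁ K₂ : NNReal} {C₀ : ℝ} (hA : ∀ p ∈ s, DifferentiableAt ℝ A p)
    (hK₁ : LipschitzOnWith K₁ A s) (hK₂ : LipschitzOnWith K₂ (fderiv ℝ A) s)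
    (hC₀ : ∀ p ∈ s, ‖A p‖ ≤ C₀)
    (hflat : ∀ p ∈ s, ∀ u v, fderiv ℝ A p u v - fderiv ℝ A p v u
      + ((A p u).comp (A p v) - (A p v).comp (A p u)) = 0)
    (hp₀ : p₀ ∈ s) {y y' : E} (hy : p₀ + y ∈ s) (hy' : p₀ + y' ∈ s) (hy1 : ‖y‖ ≤ 1)
    (hy1' : ‖y'‖ ≤ 1) (hCy' : C₀ * ‖y'‖ ≤ 1) {g g' : ℝ → G} (h0 : g' 0 = g 0) {m : ℝ}
    (hm : ∀ t ∈ Icc (0 : ℝ) 1, ‖g t‖ ≤ m)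
    (hg : ∀ t ∈ Icc (0 : ℝ) 1, HasDerivWithinAt g (-A (p₀ + t • y) y (g t)) (Icc 0 1) t)
    (hg' : ∀ t ∈ Icc (0 : ℝ) 1, HasDerivWithinAt g' (-A (p₀ + t • y') y' (g' t)) (Icc 0 1) t) :
    ‖g' 1 - g 1 + A (p₀ + y) (y' - y) (g 1)‖ ≤
      (K₂ + K₁ + (K₁ + C₀) * C₀) * m * (Real.exp 1 - 1) * ‖y' - y‖ ^ 2 := by
  have hC₀0 : 0 ≤ C₀ := (norm_nonneg _).trans (hC₀ p₀ hp₀)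
  have hm0 : 0 ≤ m := (norm_nonneg _).trans (hm 0 (by simp))
  have mem {z : E} (hz : p₀ + z ∈ s) {t : ℝ} (ht : t ∈ Icc (0 : ℝ) 1) : p₀ + t • z ∈ s :=
    hs.add_smul_mem hp₀ hz ht
  set v := y' - y with hv
  let q (t : ℝ) : G := g' t - g t + t • A (p₀ + t • y) v (g t)
  let q' (t : ℝ) : G := -A (p₀ + t • y') y' (g' t) - -A (p₀ + t • y) y (g t)
    + (t • (fderiv ℝ A (p₀ + t • y) y v (g t) + A (p₀ + t • y) v (-A (p₀ + t • y) y (g t)))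
      + (1 : ℝ) • A (p₀ + t • y) v (g t))
  have hq (t : ℝ) (ht : t ∈ Icc (0 : ℝ) 1) : HasDerivWithinAt q (q' t) (Icc 0 1) t := by
    have h1 : HasDerivAt (fun t : ℝ ↦ p₀ + t • y) y t := by
      simpa using ((hasDerivAt_id t).smul_const y).const_add p₀
    have h2 : HasDerivWithinAt (fun t : ℝ ↦ A (p₀ + t • y)) (fderiv ℝ A (p₀ + t • y) y)
        (Icc 0 1) t :=
      ((hA _ (mem hy ht)).hasFDerivAt.comp_hasDerivAt t h1).hasDerivWithinAt
    have h3 : HasDerivWithinAt (fun t : ℝ ↦ A (p₀ + t • y) v) (fderiv ℝ A (p₀ + t • y) y v)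
        (Icc 0 1) t := by
      simpa using h2.clm_apply (hasDerivWithinAt_const t (Icc 0 1) v)
    exact ((hg' t ht).sub (hg t ht)).add
      ((hasDerivWithinAt_id t _).smul (h3.clm_apply (hg t ht)))
  set ε : ℝ := (K₂ + K₁ + (K₁ + C₀) * C₀) * m * ‖v‖ ^ 2 with hε
  have bound (t : ℝ) (ht : t ∈ Icc (0 : ℝ) 1) : ‖q' t‖ ≤ 1 * ‖q t‖ + ε := by
    set p := p₀ + t • y with hp
    set p' := p₀ + t • y' with hp'
    have hps : p ∈ s := mem hy ht
    have hps' : p' ∈ s := mem hy' ht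
    have hpp : p' - p = t • v := by simp [hp, hp', hv, smul_sub]
    have hfl := congrArg (fun T : G →L[ℝ] G ↦ t • T (g t)) (hflat p hps y v)
    have hsplit : q' t = -A p' y' (q t) - (A p' - A p - fderiv ℝ A p (p' - p)) y (g t)
        - (A p' - A p) v (g t) + t • ((A p' - A p) y' + A p v) (A p v (g t)) := by
      have hyv : y' = y + v := by simp [hv]
      simp only [q, q', ← hp, ← hp']
      simp only [hpp, hyv]
      simp only [_root_.add_apply, _root_.sub_apply, ContinuousLinearMap.comp_apply, smul_add,
        smul_sub, _root_.zero_apply, smul_zero] at hfl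
      simp only [map_add, map_sub, map_smul, map_neg, _root_.add_apply, _root_.sub_apply,
        _root_.smul_apply, smul_add, smul_sub, smul_neg, one_smul]
      rw [← sub_eq_zero] at hfl ⊢
      rw [← hfl]
      abel
    have ht0 := ht.1
    have ht1 := ht.2
    have hpn : ‖p' - p‖ ≤ ‖v‖ := by
      rw [hpp, norm_smul, Real.norm_of_nonneg ht0]
      exact mul_le_of_le_one_left (norm_nonneg _) ht1
    have hgt := hm t ht
    have hd : ‖A p' - A p‖ ≤ K₁ * ‖v‖ :=
      (hK₁.norm_sub_le hps' hps).trans (by gcongr)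
    have e1 : ‖A p' y' (q t)‖ ≤ ‖q t‖ := by
      refine ((A p').le_opNorm₂ y' (q t)).trans ?_
      refine mul_le_of_le_one_left (norm_nonneg _) (le_trans ?_ hCy')
      gcongr
      exact hC₀ p' hps'
    have e2 : ‖(A p' - A p - fderiv ℝ A p (p' - p)) y (g t)‖ ≤ K₂ * ‖v‖ ^ 2 * 1 * m := by
      refine (ContinuousLinearMap.le_opNorm₂ _ y (g t)).trans ?_
      gcongr
      exact (norm_sub_sub_fderiv_le hs hA hK₂ hps hps').trans (by gcongr)
    have e3 : ‖(A p' - A p) v (g t)‖ ≤ K₁ * ‖v‖ * ‖v‖ * m := by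
      refine (ContinuousLinearMap.le_opNorm₂ _ v (g t)).trans ?_
      gcongr
    have e4 : ‖(A p' - A p) y' + A p v‖ ≤ K₁ * ‖v‖ * 1 + C₀ * ‖v‖ := by
      refine (norm_add_le _ _).trans (add_le_add ?_ ?_)
      · exact (ContinuousLinearMap.le_opNorm _ _).trans (by gcongr)
      · exact (ContinuousLinearMap.le_opNorm _ _).trans (by gcongr; exact hC₀ p hps)
    have e5 : ‖A p v (g t)‖ ≤ C₀ * ‖v‖ * m := by
      refine ((A p).le_opNorm₂ v (g t)).trans ?_
      gcongr
      exact hC₀ p hps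
    have e6 : ‖t • ((A p' - A p) y' + A p v) (A p v (g t))‖
        ≤ 1 * ((K₁ * ‖v‖ * 1 + C₀ * ‖v‖) * (C₀ * ‖v‖ * m)) := by
      rw [norm_smul, Real.norm_of_nonneg ht0]
      gcongr
      exact (ContinuousLinearMap.le_opNorm _ _).trans (by gcongr)
    rw [hsplit]
    calc _ ≤ ‖q t‖ + K₂ * ‖v‖ ^ 2 * 1 * m + K₁ * ‖v‖ * ‖v‖ * m
          + 1 * ((K₁ * ‖v‖ * 1 + C₀ * ‖v‖) * (C₀ * ‖v‖ * m)) := by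
          refine (norm_add_le _ _).trans (add_le_add ((norm_sub_le _ _).trans
            (add_le_add ((norm_sub_le _ _).trans (add_le_add ?_ e2)) e3)) e6)
          rwa [norm_neg]
      _ = 1 * ‖q t‖ + ε := by rw [hε]; ring
  have key := norm_le_gronwallBound_of_norm_deriv_right_le (f := q) (f' := q') (δ := 0) (K := 1)
    (ε := ε) (a := 0) (b := 1) (fun t ht ↦ (hq t ht).continuousWithinAt)
    (fun t ht ↦ (hq t ⟨ht.1, ht.2.le⟩).mono_of_mem_nhdsWithin
      (Icc_mem_nhdsGE_of_mem ht)) (by simp [q, h0])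
    (fun t ht ↦ bound t ⟨ht.1, ht.2.le⟩) 1 (by simp)
  rw [gronwallBound_of_K_ne_0 one_ne_zero] at key
  refine le_trans (by simp [q]) (key.trans_eq ?_)
  rw [hε]
  simp
  ring

open Metric in
/-- Existence of solutions of flat linear total differential equations `df = -A f`. -/
theorem exists_solution_of_flat [CompleteSpace G] {A : E → E →L[ℝ] G →L[ℝ] G} {O : Set E}
    (hO : IsOpen O) (hA : ContDiffOn ℝ ∞ A O)
    (hflat : ∀ p ∈ O, ∀ u v, fderiv ℝ A p u v - fderiv ℝ A p v u
      + ((A p u).comp (A p v) - (A p v).comp (A p u)) = 0)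
    {p₀ : E} (hp₀ : p₀ ∈ O) : ∃ r > 0, ball p₀ r ⊆ O ∧ ∀ c : G, ∃ f : E → G,
      f p₀ = c ∧ ContDiffOn ℝ ∞ f (ball p₀ r) ∧
        ∀ p ∈ ball p₀ r, HasFDerivAt f (-(A p).flip (f p)) p := by
  have hA₀ : ContDiffAt ℝ ∞ A p₀ := hA.contDiffAt (hO.mem_nhds hp₀)
  obtain ⟨K₁, t₁, ht₁, hK₁⟩ := (hA₀.of_le (m := 1) (mod_cast le_top)).exists_lipschitzOnWith
  obtain ⟨K₂, t₂, ht₂, hK₂⟩ :=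
    (hA₀.fderiv_right (m := 1) (n := ∞) (by norm_cast)).exists_lipschitzOnWith
  have hbd : ∀ᶠ p in 𝓝 p₀, ‖A p‖ < ‖A p₀‖ + 1 :=
    hA₀.continuousAt.norm.eventually_lt_const (by simp)
  obtain ⟨ρ, hρ, hρs⟩ := Metric.mem_nhds_iff.1
    (Filter.inter_mem (Filter.inter_mem ht₁ ht₂) (Filter.inter_mem (hO.mem_nhds hp₀) hbd))
  set C₀ := ‖A p₀‖ + 1 with hC₀def
  have hC₀ : 0 < C₀ := by positivity
  let r := min ρ (min 1 (1 / (2 * C₀)))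
  have hr : 0 < r := by positivity
  have hsub : ball p₀ r ⊆ ball p₀ ρ := ball_subset_ball (min_le_left _ _)
  have hrO : ball p₀ r ⊆ O := fun p hp ↦ (hρs (hsub hp)).2.1
  have hdiff : ∀ p ∈ ball p₀ r, DifferentiableAt ℝ A p := fun p hp ↦
    (hA.contDiffAt (hO.mem_nhds (hrO hp))).differentiableAt (by simp)
  have hbound : ∀ p ∈ ball p₀ r, ‖A p‖ ≤ C₀ := fun p hp ↦ (hρs (hsub hp)).2.2.le
  refine ⟨r, hr, hrO, fun c ↦ ?_⟩
  have hnorm {y : E} (hy : p₀ + y ∈ ball p₀ r) : ‖y‖ ≤ 1 ∧ C₀ * ‖y‖ ≤ 1 / 2 := by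
    have h : ‖y‖ < r := by simpa using hy
    refine ⟨(h.trans_le ((min_le_right _ _).trans (min_le_left _ _))).le, ?_⟩
    have := h.le.trans ((min_le_right _ _).trans (min_le_right _ _))
    calc C₀ * ‖y‖ ≤ C₀ * (1 / (2 * C₀)) := by gcongr
      _ = 1 / 2 := by field_simp
  have hex (y : E) (hy : p₀ + y ∈ ball p₀ r) : ∃ g : ℝ → G, g 0 = c ∧ ∀ t ∈ Icc (0 : ℝ) 1,
      HasDerivWithinAt g (-A (p₀ + t • y) y (g t)) (Icc 0 1) t := by
    have hmem (t : ℝ) (ht : t ∈ Icc (0 : ℝ) 1) : p₀ + t • y ∈ ball p₀ r :=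
      (convex_ball p₀ r).add_smul_mem (mem_ball_self hr) hy ht
    refine exists_linearODE_solution (B := fun t ↦ A (p₀ + t • y) y) ?_ (fun t ht ↦ ?_) c
    · refine ContinuousOn.clm_apply (fun t ht ↦ ?_) continuousOn_const
      exact (ContinuousAt.comp (g := A) (f := fun t : ℝ ↦ p₀ + t • y)
        (hdiff _ (hmem t ht)).continuousAt (by fun_prop)).continuousWithinAt
    · refine ((A (p₀ + t • y)).le_opNorm y).trans (le_trans ?_ (hnorm hy).2)
      gcongr
      exact hbound _ (hmem t ht)
  choose! g hg0 hg using hex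
  have hfd : ∀ p ∈ ball p₀ r, HasFDerivAt (fun p ↦ g (p - p₀) 1)
      (-(A p).flip (g (p - p₀) 1)) p := by
    intro p hp
    have hpy : p₀ + (p - p₀) ∈ ball p₀ r := by simpa using hp
    obtain ⟨m, hm⟩ := isCompact_Icc.exists_bound_of_continuousOn
      (fun t ht ↦ (hg _ hpy t ht).continuousWithinAt)
    rw [hasFDerivAt_iff_isLittleO_nhds_zero]
    have hbig : (fun h : E ↦ g (p + h - p₀) 1 - g (p - p₀) 1 - (-(A p).flip (g (p - p₀) 1)) h)
        =O[𝓝 0] fun h : E ↦ ‖h‖ ^ 2 := by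
      refine Asymptotics.IsBigO.of_bound
        ((K₂ + K₁ + (K₁ + C₀) * C₀) * m * (Real.exp 1 - 1)) ?_
      have hev : ∀ᶠ h : E in 𝓝 0, p + h ∈ ball p₀ r :=
        (by fun_prop : ContinuousAt (fun h : E ↦ p + h) 0).eventually_mem
          (isOpen_ball.mem_nhds (by simpa using hp))
      filter_upwards [hev] with h hh
      have hpy' : p₀ + (p + h - p₀) ∈ ball p₀ r := by simpa using hh
      have key := norm_radialSolution_sub_le (convex_ball p₀ r) hdiff
        (hK₁.mono fun q hq ↦ (hρs (hsub hq)).1.1) (hK₂.mono fun q hq ↦ (hρs (hsub hq)).1.2)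
        hbound (fun q hq ↦ hflat q (hrO hq)) (mem_ball_self hr) hpy hpy' (hnorm hpy).1
        (hnorm hpy').1 ((hnorm hpy').2.trans (by norm_num))
        ((hg0 _ hpy').trans (hg0 _ hpy).symm) hm (hg _ hpy) (hg _ hpy')
      simpa using key
    exact hbig.trans_isLittleO (by
      simpa using (Asymptotics.isLittleO_norm_pow_id (E' := E) one_lt_two))
  have h0 : p₀ + (0 : E) ∈ ball p₀ r := by simpa using hr
  have hconst := constant_of_has_deriv_right_zero (a := 0) (b := 1)
    (fun t ht ↦ (hg 0 h0 t ht).continuousWithinAt) (fun t ht ↦ by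
      simpa using (hg 0 h0 t ⟨ht.1, ht.2.le⟩).mono_of_mem_nhdsWithin
        (Icc_mem_nhdsGE_of_mem ht)) 1 (by simp)
  exact ⟨fun p ↦ g (p - p₀) 1, by simpa [hg0 0 h0] using hconst,
    contDiffOn_of_hasFDerivAt_clm isOpen_ball (hA.mono hrO) hfd, hfd⟩

end TotalDifferentialEquations

section CoordinateFields

variable {E : Type*} [NormedAddCommGroup E] [NormedSpace ℝ E]
  {H : Type*} [TopologicalSpace H] {I : ModelWithCorners ℝ E H}
  {M : Type*} [TopologicalSpace M] [ChartedSpace H M] [IsManifold I ∞ M]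

variable (I) in
/-- The coordinate vector field in the direction `v` of the preferred chart at `x₀`. -/
def coordField (x₀ : M) (v : E) (y : M) : TangentSpace I y :=
  (trivializationAt E (TangentSpace I) x₀).symm y v

lemma isLocalSection_coordField (x₀ : M) (v : E) :
    IsLocalSection I E (coordField I x₀ v) (chartAt H x₀).source := by
  refine ⟨(chartAt H x₀).open_source, fun y hy ↦ ?_⟩
  have hb : y ∈ (trivializationAt E (TangentSpace I : M → Type _) x₀).baseSet := hy
  rw [(trivializationAt E (TangentSpace I) x₀).contMDiffWithinAt_section _ hb]
  refine (contMDiffOn_const (c := v)).congr (fun z hz ↦ ?_) y hy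
  have hz' : z ∈ (trivializationAt E (TangentSpace I : M → Type _) x₀).baseSet := hz
  exact congrArg Prod.snd
    ((trivializationAt E (TangentSpace I : M → Type _) x₀).apply_mk_symm hz' v)

lemma coordField_eq_symmL {x₀ y : M} (hy : y ∈ (chartAt H x₀).source) (v : E) :
    coordField I x₀ v y = (trivializationAt E (TangentSpace I : M → Type _) x₀).symmL ℝ y v :=
  ((trivializationAt E (TangentSpace I : M → Type _) x₀).symmL_apply (R := ℝ) hy v).symm

lemma mfderiv_extChartAt_coordField {x₀ y : M} (hy : y ∈ (chartAt H x₀).source) (v : E) :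
    mfderiv I 𝓘(ℝ, E) (extChartAt I x₀) y (coordField I x₀ v y) = v := by
  have hb : y ∈ (trivializationAt E (TangentSpace I : M → Type _) x₀).baseSet := hy
  rw [← TangentBundle.continuousLinearMapAt_trivializationAt hy, coordField_eq_symmL hy]
  exact (trivializationAt E (TangentSpace I : M → Type _) x₀).continuousLinearMapAt_symmL
    (R := ℝ) hb v

/-- The constant vector field `v` on a vector space. -/
def constField (v z : E) : TangentSpace 𝓘(ℝ, E) z := v

lemma coordField_eq_mpullback {x₀ y : M} (hy : y ∈ (chartAt H x₀).source) (v : E) :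
    coordField I x₀ v y =
      VectorField.mpullback I 𝓘(ℝ, E) (extChartAt I x₀) (constField v) y := by
  have hinv := isInvertible_mfderiv_extChartAt (I := I) (x := x₀) (y := y)
    (by simpa [extChartAt_source] using hy)
  rw [VectorField.mpullback_apply, eq_comm, hinv.inverse_apply_eq]
  exact (mfderiv_extChartAt_coordField hy v).symm

lemma exists_coordField_eq {x₀ y : M} (hy : y ∈ (chartAt H x₀).source) (u : TangentSpace I y) :
    ∃ v : E, coordField I x₀ v y = u := by
  have hb : y ∈ (trivializationAt E (TangentSpace I : M → Type _) x₀).baseSet := hy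
  exact ⟨(trivializationAt E (TangentSpace I : M → Type _) x₀ ⟨y, u⟩).2,
    (trivializationAt E (TangentSpace I : M → Type _) x₀).symm_proj_apply ⟨y, u⟩ hb⟩

lemma mlieBracket_coordField [CompleteSpace E] {x₀ y : M} (hy : y ∈ (chartAt H x₀).source)
    (u v : E) : VectorField.mlieBracket I (coordField I x₀ u) (coordField I x₀ v) y = 0 := by
  have hev (w : E) : coordField I x₀ w =ᶠ[𝓝 y]
      VectorField.mpullback I 𝓘(ℝ, E) (extChartAt I x₀) (constField w) := by
    filter_upwards [(chartAt H x₀).open_source.mem_nhds hy] with z hz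
    exact coordField_eq_mpullback hz w
  have hc (w : E) : MDifferentiableAt 𝓘(ℝ, E) (𝓘(ℝ, E).prod 𝓘(ℝ, E))
      (fun z : E ↦ (⟨z, constField w z⟩ : TotalSpace E (TangentSpace 𝓘(ℝ, E))))
      (extChartAt I x₀ y) := by
    rw [mdifferentiableAt_section]
    exact (mdifferentiableAt_const (c := w)).congr_of_eventuallyEq
      (.of_forall fun z ↦ by simp; rfl)
  have : IsManifold I (minSmoothness ℝ 2) M := by
    rw [minSmoothness_of_isRCLikeNormedField]
    exact .of_le (n := ∞) (by norm_cast)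
  rw [(hev u).mlieBracket_vectorField_eq (hev v),
    ← VectorField.mpullback_mlieBracket (n := 2) (hc u) (hc v)
      ((contMDiffAt_extChartAt' hy)) (by simp),
    VectorField.mpullback_apply]
  have h0 (z : E) :
      VectorField.mlieBracket 𝓘(ℝ, E) (constField u) (constField v) z = 0 := by
    rw [← VectorField.mlieBracketWithin_univ, VectorField.mlieBracketWithin_eq_lieBracketWithin]
    change VectorField.lieBracketWithin ℝ (fun _ : E ↦ u) (fun _ : E ↦ v) univ z = 0
    simp [VectorField.lieBracketWithin]
  rw [h0]
  exact map_zero (mfderiv I 𝓘(ℝ, E) (extChartAt I x₀) y).inverse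

variable {G : Type*} [NormedAddCommGroup G] [NormedSpace ℝ G]

lemma mvfderiv_congr {p q : M → G} {y : M} (h : p =ᶠ[𝓝 y] q) :
    mvfderiv I p y = mvfderiv I q y :=
  h.mfderiv_eq

lemma contDiffOn_comp_extChartAt_symm [I.Boundaryless] {x₀ : M} {p : M → G} {U : Set M}
    (hp : ContMDiffOn I 𝓘(ℝ, G) ∞ p U) :
    ContDiffOn ℝ ∞ (p ∘ (extChartAt I x₀).symm)
      ((extChartAt I x₀).target ∩ (extChartAt I x₀).symm ⁻¹' U) := by
  rw [← contMDiffOn_iff_contDiffOn]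
  exact hp.comp ((contMDiffOn_extChartAt_symm x₀).mono inter_subset_left) fun z hz ↦ hz.2

lemma mvfderiv_comp_extChartAt_coordField {x₀ y : M} (hy : y ∈ (chartAt H x₀).source)
    {Q : E → G} (hQ : DifferentiableAt ℝ Q (extChartAt I x₀ y)) (v : E) :
    mvfderiv I (fun z ↦ Q (extChartAt I x₀ z)) y (coordField I x₀ v y) =
      fderiv ℝ Q (extChartAt I x₀ y) v := by
  have h := mfderiv_comp_apply (I := I) (I' := 𝓘(ℝ, E)) (I'' := 𝓘(ℝ, G)) (g := Q) y
    hQ.mdifferentiableAt (mdifferentiableAt_extChartAt hy) (coordField I x₀ v y)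
  rw [mfderiv_extChartAt_coordField hy] at h
  refine Eq.trans h ?_
  rw [mfderiv_eq_fderiv]
  rfl

lemma isOpen_extChartAt_target_inter [I.Boundaryless] {x₀ : M} {U : Set M} (hU : IsOpen U) :
    IsOpen ((extChartAt I x₀).target ∩ (extChartAt I x₀).symm ⁻¹' U) :=
  (continuousOn_extChartAt_symm x₀).isOpen_inter_preimage (isOpen_extChartAt_target x₀) hU

lemma mvfderiv_coordField [I.Boundaryless] {x₀ y : M} {U : Set M} (hU : IsOpen U) (hyU : y ∈ U)
    (hy : y ∈ (chartAt H x₀).source) {p : M → G} (hp : ContMDiffOn I 𝓘(ℝ, G) ∞ p U) (v : E) :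
    mvfderiv I p y (coordField I x₀ v y) =
      fderiv ℝ (p ∘ (extChartAt I x₀).symm) (extChartAt I x₀ y) v := by
  have hy' : y ∈ (extChartAt I x₀).source := by simpa [extChartAt_source] using hy
  have hmem : extChartAt I x₀ y ∈ (extChartAt I x₀).target ∩ (extChartAt I x₀).symm ⁻¹' U :=
    ⟨(extChartAt I x₀).map_source hy', by
      rwa [mem_preimage, (extChartAt I x₀).left_inv hy']⟩
  rw [← mvfderiv_comp_extChartAt_coordField hy
    (((contDiffOn_comp_extChartAt_symm hp).contDiffAt
      ((isOpen_extChartAt_target_inter hU).mem_nhds hmem)).differentiableAt (by simp))]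
  have : p =ᶠ[𝓝 y] fun z ↦ (p ∘ (extChartAt I x₀).symm) (extChartAt I x₀ z) := by
    filter_upwards [(chartAt H x₀).open_source.mem_nhds hy] with z hz
    have hz' : z ∈ (extChartAt I x₀).source := by simpa [extChartAt_source] using hz
    rw [Function.comp_apply, (extChartAt I x₀).left_inv hz']
  exact congrArg (· (coordField I x₀ v y)) (mvfderiv_congr this)

/-- Coordinate vector fields commute on smooth functions. -/
lemma mvfderiv_mvfderiv_coordField_comm [I.Boundaryless] {x₀ y : M} {U : Set M} (hU : IsOpen U)
    (hyU : y ∈ U) (hUs : U ⊆ (chartAt H x₀).source) {p : M → G}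
    (hp : ContMDiffOn I 𝓘(ℝ, G) ∞ p U) (u v : E) :
    mvfderiv I (fun z ↦ mvfderiv I p z (coordField I x₀ v z)) y (coordField I x₀ u y) =
      mvfderiv I (fun z ↦ mvfderiv I p z (coordField I x₀ u z)) y (coordField I x₀ v y) := by
  have hy := hUs hyU
  have hy' : y ∈ (extChartAt I x₀).source := by simpa [extChartAt_source] using hy
  have hmem : extChartAt I x₀ y ∈ (extChartAt I x₀).target ∩ (extChartAt I x₀).symm ⁻¹' U :=
    ⟨(extChartAt I x₀).map_source hy', by
      rwa [mem_preimage, (extChartAt I x₀).left_inv hy']⟩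
  have hP : ContDiffAt ℝ ∞ (p ∘ (extChartAt I x₀).symm) (extChartAt I x₀ y) :=
    (contDiffOn_comp_extChartAt_symm hp).contDiffAt
      ((isOpen_extChartAt_target_inter hU).mem_nhds hmem)
  have hdiff : DifferentiableAt ℝ (fderiv ℝ (p ∘ (extChartAt I x₀).symm)) (extChartAt I x₀ y) :=
    (hP.fderiv_right (m := 1) (by norm_cast)).differentiableAt (by simp)
  have key (u v : E) :
      mvfderiv I (fun z ↦ mvfderiv I p z (coordField I x₀ v z)) y (coordField I x₀ u y) =
        fderiv ℝ (fderiv ℝ (p ∘ (extChartAt I x₀).symm)) (extChartAt I x₀ y) u v := by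
    have hev : (fun z ↦ mvfderiv I p z (coordField I x₀ v z)) =ᶠ[𝓝 y]
        fun z ↦ (fun q ↦ fderiv ℝ (p ∘ (extChartAt I x₀).symm) q v) (extChartAt I x₀ z) := by
      filter_upwards [hU.mem_nhds hyU] with z hz
      exact mvfderiv_coordField hU hz (hUs hz) hp v
    have h1 := mvfderiv_comp_extChartAt_coordField hy
      (hdiff.clm_apply (differentiableAt_const v)) u
    rw [fderiv_clm_apply hdiff (differentiableAt_const v)] at h1
    simp only [fderiv_fun_const, Pi.zero_apply, ContinuousLinearMap.comp_zero, zero_add,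
      ContinuousLinearMap.flip_apply] at h1
    rw [← h1]
    exact congrArg (· (coordField I x₀ u y)) (mvfderiv_congr hev)
  rw [key, key]
  exact (hP.isSymmSndFDerivAt (by simp; norm_cast)) u v

end CoordinateFields

section Curvature

variable {E : Type*} [NormedAddCommGroup E] [NormedSpace ℝ E]
  {H : Type*} [TopologicalSpace H] {I : ModelWithCorners ℝ E H}
  {M : Type*} [TopologicalSpace M] [ChartedSpace H M] [IsManifold I ∞ M]
  {F : Type*} [NormedAddCommGroup F] [NormedSpace ℝ F]
  {W : M → Type*} [TopologicalSpace (TotalSpace F W)]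
  [∀ x, AddCommGroup (W x)] [∀ x, Module ℝ (W x)]
  [∀ x, TopologicalSpace (W x)]
  [∀ x, IsTopologicalAddGroup (W x)] [∀ x, ContinuousSMul ℝ (W x)]
  [FiberBundle F W] [VectorBundle ℝ F W]

lemma IsLocalSection.sum_smul {ι : Type*} {s : Finset ι} {c : ι → M → ℝ} {X : ι → Π x : M, W x}
    {U : Set M} (hU : IsOpen U) (hc : ∀ i, ContMDiffOn I 𝓘(ℝ, ℝ) ∞ (c i) U)
    (hX : ∀ i, IsLocalSection I F (X i) U) :
    IsLocalSection I F (fun z ↦ ∑ i ∈ s, c i z • X i z) U :=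
  ⟨hU, ContMDiffOn.sum_section fun i _ ↦ (hc i).smul_section (hX i).smooth⟩

lemma Connection.toFun_congr (D : Connection I F W) {U : Set M} {x : M} (hx : x ∈ U)
    {X X' : Π x : M, W x} (hX : IsLocalSection I F X U)
    (hX' : IsLocalSection I F X' U) (h : ∀ y ∈ U, X y = X' y) :
    D.toFun X x = D.toFun X' x :=
  D.isCovariantDerivativeOnUniv.mono (subset_univ U)
    |>.congr_of_eqOn (hX.mdifferentiableAt hx) (hX'.mdifferentiableAt hx)
      (hX.isOpen.mem_nhds hx) h

lemma Connection.toFun_sub (D : Connection I F W) {U : Set M} {x : M} (hx : x ∈ U)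
    {X X' : Π x : M, W x} (hX : IsLocalSection I F X U)
    (hX' : IsLocalSection I F X' U) :
    D.toFun (X - X') x = D.toFun X x - D.toFun X' x := by
  have h : X - X' = X + (-1 : ℝ) • X' := by simp [sub_eq_add_neg]
  rw [h, D.isCovariantDerivativeOnUniv.add (hX.mdifferentiableAt hx)
    ((hX'.smul _).mdifferentiableAt hx), D.isCovariantDerivativeOnUniv.smul_const _
    (hX'.mdifferentiableAt hx)]
  simp [sub_eq_add_neg]

lemma IsLocalSection.sub {X X' : Π x : M, W x} {U : Set M}
    (hX : IsLocalSection I F X U) (hX' : IsLocalSection I F X' U) :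
    IsLocalSection I F (X - X') U :=
  ⟨hX.isOpen, hX.smooth.sub_section hX'.smooth⟩

lemma Connection.toFun_sum_smul (D : Connection I F W) {ι : Type*} {s : Finset ι}
    {c : ι → M → ℝ} {X : ι → Π x : M, W x} {U : Set M} (hU : IsOpen U)
    (hc : ∀ i, ContMDiffOn I 𝓘(ℝ, ℝ) ∞ (c i) U) (hX : ∀ i, IsLocalSection I F (X i) U) {x : M}
    (hx : x ∈ U) (v : TangentSpace I x) :
    D.toFun (fun z ↦ ∑ i ∈ s, c i z • X i z) x v =
      ∑ i ∈ s, (c i x • D.toFun (X i) x v + mvfderiv I (c i) x v • X i x) := by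
  classical
  have hc' (i : ι) : MDifferentiableAt I 𝓘(ℝ, ℝ) (c i) x :=
    ((hc i).contMDiffAt (hU.mem_nhds hx)).mdifferentiableAt (by simp)
  have hX' (i : ι) := (hX i).mdifferentiableAt hx
  induction s using Finset.induction_on with
  | empty =>
    have h : (fun z : M ↦ ∑ i ∈ (∅ : Finset ι), c i z • X i z) = 0 := by
      funext z
      simp
    rw [h, D.isCovariantDerivativeOnUniv.zero]
    simp
  | insert a s ha ih =>
    have h : (fun z ↦ ∑ i ∈ insert a s, c i z • X i z) =
        (c a • X a) + fun z ↦ ∑ i ∈ s, c i z • X i z := by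
      funext z
      simp [Finset.sum_insert ha]
    rw [h, D.isCovariantDerivativeOnUniv.add ((hc' a).smul_section (hX' a))
      ((IsLocalSection.sum_smul hU hc hX).mdifferentiableAt hx),
      D.isCovariantDerivativeOnUniv.leibniz (hX' a) (hc' a), Finset.sum_insert ha]
    rw [_root_.add_apply, ih]
    simp

/-- The expression `∇_Y ∇_Z X - ∇_Z ∇_Y X - ∇_[Y, Z] X` for vector fields `Y`, `Z` and a
section `X`. -/
def Connection.curvatureFields (D : Connection I F W) (Y Z : Π x : M, TangentSpace I x)
    (X : Π x : M, W x) (x : M) : W x :=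
  D.deriv Y (D.deriv Z X) x - D.deriv Z (D.deriv Y X) x
    - D.deriv (VectorField.mlieBracket I Y Z) X x

lemma Connection.mdifferentiableAt_deriv (D : Connection I F W) {U : Set M} {x : M} (hx : x ∈ U)
    {Y : Π x : M, TangentSpace I x} {X : Π x : M, W x} (hX : IsLocalSection I F X U)
    (hY : MDifferentiableAt I (I.prod 𝓘(ℝ, E)) (fun y ↦ TotalSpace.mk' E y (Y y)) x) :
    MDifferentiableAt I (I.prod 𝓘(ℝ, F)) (fun y ↦ TotalSpace.mk' F y (D.deriv Y X y)) x := by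
  have h := (((D.smooth U hX.isOpen).contMDiff (σ := X) (by simpa using hX.smooth)).contMDiffAt
    (hX.isOpen.mem_nhds hx)).mdifferentiableAt (by simp)
  exact h.clm_bundle_apply hY

variable [CompleteSpace E]

lemma Connection.curvatureFields_tensorialAt (D : Connection I F W) {U : Set M} {x : M}
    (hx : x ∈ U) (Z : Π x : M, TangentSpace I x) {X : Π x : M, W x}
    (hX : IsLocalSection I F X U) :
    TensorialAt I E (fun Y ↦ D.curvatureFields Y Z X x) x where
  smul {f Y} hf hY := by
    have h1 : D.deriv (f • Y) X = f • D.deriv Y X := by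
      funext z
      simp [Connection.deriv]
    have h2 := D.isCovariantDerivativeOnUniv.leibniz (D.mdifferentiableAt_deriv hx hX hY) hf
    have : IsManifold I 2 M := .of_le (n := ∞) (by norm_cast)
    have h3 := VectorField.mlieBracket_smul_left (W := Z) hf hY
    simp only [Connection.curvatureFields, h1]
    simp only [Connection.deriv, h2, h3]
    simp
    module
  add {Y Y'} hY hY' := by
    have h1 : D.deriv (Y + Y') X = D.deriv Y X + D.deriv Y' X := by
      funext z
      simp [Connection.deriv]
    have h2 := D.isCovariantDerivativeOnUniv.add (D.mdifferentiableAt_deriv hx hX hY)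
      (D.mdifferentiableAt_deriv hx hX hY')
    have : IsManifold I 2 M := .of_le (n := ∞) (by norm_cast)
    have h3 := VectorField.mlieBracket_add_left (W := Z) hY hY'
    simp only [Connection.curvatureFields, h1]
    simp only [Connection.deriv, h2, h3]
    simp
    module

lemma Connection.curvatureFields_swap (D : Connection I F W) (Y Z : Π x : M, TangentSpace I x)
    (X : Π x : M, W x) (x : M) : D.curvatureFields Y Z X x = -D.curvatureFields Z Y X x := by
  simp only [Connection.curvatureFields, Connection.deriv,
    VectorField.mlieBracket_swap_apply (V := Y) (W := Z), map_neg]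
  abel

lemma Connection.curvatureFields_congr_fields [FiniteDimensional ℝ E] (D : Connection I F W)
    {U : Set M} {x : M} (hx : x ∈ U)
    {X : Π x : M, W x} (hX : IsLocalSection I F X U) {Y Y' Z Z' : Π x : M, TangentSpace I x}
    (hY : MDifferentiableAt I (I.prod 𝓘(ℝ, E)) (fun y ↦ TotalSpace.mk' E y (Y y)) x)
    (hY' : MDifferentiableAt I (I.prod 𝓘(ℝ, E)) (fun y ↦ TotalSpace.mk' E y (Y' y)) x)
    (hZ : MDifferentiableAt I (I.prod 𝓘(ℝ, E)) (fun y ↦ TotalSpace.mk' E y (Z y)) x)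
    (hZ' : MDifferentiableAt I (I.prod 𝓘(ℝ, E)) (fun y ↦ TotalSpace.mk' E y (Z' y)) x)
    (hYY' : Y x = Y' x) (hZZ' : Z x = Z' x) :
    D.curvatureFields Y Z X x = D.curvatureFields Y' Z' X x := by
  have : ContMDiffVectorBundle 1 E (TangentSpace I : M → Type _) I :=
    .of_le (n := ∞) (by norm_cast)
  rw [(D.curvatureFields_tensorialAt hx Z hX).pointwise hY hY' hYY',
    D.curvatureFields_swap Y' Z, (D.curvatureFields_tensorialAt hx Y' hX).pointwise hZ hZ' hZZ',
    ← D.curvatureFields_swap]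

/-- The commutator of the covariant derivatives along two coordinate vector fields. -/
def Connection.coordCommutator (D : Connection I F W) (x₀ : M) (u v : E) (X : Π x : M, W x)
    (x : M) : W x :=
  D.deriv (coordField I x₀ u) (D.deriv (coordField I x₀ v) X) x
    - D.deriv (coordField I x₀ v) (D.deriv (coordField I x₀ u) X) x

lemma Connection.curvatureFields_coordField (D : Connection I F W) {x₀ x : M}
    (hx : x ∈ (chartAt H x₀).source) (u v : E) (X : Π x : M, W x) :
    D.curvatureFields (coordField I x₀ u) (coordField I x₀ v) X x =
      D.coordCommutator x₀ u v X x := by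
  have h : D.deriv (VectorField.mlieBracket I (coordField I x₀ u) (coordField I x₀ v)) X x = 0 := by
    simp [Connection.deriv, mlieBracket_coordField hx]
  rw [Connection.curvatureFields, h, sub_zero]
  rfl

lemma IsLocalSection.coordCommutator {D : Connection I F W} {x₀ : M} {U : Set M}
    (hUs : U ⊆ (chartAt H x₀).source) {X : Π x : M, W x} (hX : IsLocalSection I F X U) (u v : E) :
    IsLocalSection I F (D.coordCommutator x₀ u v X) U := by
  have hS (v : E) := (isLocalSection_coordField (I := I) x₀ v).mono hX.isOpen hUs
  exact ((hX.deriv (hS v)).deriv (hS u)).sub ((hX.deriv (hS u)).deriv (hS v))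

lemma Connection.coordCommutator_sum_smul [FiniteDimensional ℝ E] [I.Boundaryless]
    (D : Connection I F W) {x₀ : M}
    {U : Set M} (hU : IsOpen U)
    (hUs : U ⊆ (chartAt H x₀).source) {ι : Type*} {s : Finset ι}
    {c : ι → M → ℝ} {X : ι → Π x : M, W x}
    (hc : ∀ i, ContMDiffOn I 𝓘(ℝ, ℝ) ∞ (c i) U) (hX : ∀ i, IsLocalSection I F (X i) U) {x : M}
    (hx : x ∈ U) (u v : E) :
    D.coordCommutator x₀ u v (fun z ↦ ∑ i ∈ s, c i z • X i z) x =
      ∑ i ∈ s, c i x • D.coordCommutator x₀ u v (X i) x := by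
  have hS (v : E) := (isLocalSection_coordField (I := I) x₀ v).mono hU hUs
  have hsum := IsLocalSection.sum_smul (s := s) hU hc hX
  have hdc (v : E) (i : ι) : ContMDiffOn I 𝓘(ℝ, ℝ) ∞
      (fun z ↦ mvfderiv I (c i) z (coordField I x₀ v z)) U :=
    contMDiffOn_mvfderiv_apply (hc i) (hS v)
  have key (u v : E) : D.deriv (coordField I x₀ u) (D.deriv (coordField I x₀ v)
      (fun z ↦ ∑ i ∈ s, c i z • X i z)) x =
      ∑ i ∈ s, (c i x • D.deriv (coordField I x₀ u) (D.deriv (coordField I x₀ v) (X i)) x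
        + mvfderiv I (c i) x (coordField I x₀ u x) • D.deriv (coordField I x₀ v) (X i) x
        + (mvfderiv I (c i) x (coordField I x₀ v x) • D.deriv (coordField I x₀ u) (X i) x
        + mvfderiv I (fun z ↦ mvfderiv I (c i) z (coordField I x₀ v z)) x (coordField I x₀ u x)
          • X i x)) := by
    have h1 : ∀ z ∈ U, D.deriv (coordField I x₀ v) (fun z ↦ ∑ i ∈ s, c i z • X i z) z =
        ((fun z ↦ ∑ i ∈ s, c i z • D.deriv (coordField I x₀ v) (X i) z) +
          fun z ↦ ∑ i ∈ s, mvfderiv I (c i) z (coordField I x₀ v z) • X i z) z := by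
      intro z hz
      rw [Pi.add_apply, ← Finset.sum_add_distrib]
      exact D.toFun_sum_smul hU hc hX hz _
    have hA := IsLocalSection.sum_smul (s := s) hU hc fun i ↦ (hX i).deriv (D := D) (hS v)
    have hB := IsLocalSection.sum_smul (s := s) hU (hdc v) hX
    rw [D.deriv_congr hx _ (hsum.deriv (hS v)) (hA.add hB) h1, D.deriv_add hx _ hA hB]
    rw [Finset.sum_add_distrib]
    exact congrArg₂ (· + ·) (D.toFun_sum_smul hU hc (fun i ↦ (hX i).deriv (hS v)) hx _)
      (D.toFun_sum_smul hU (hdc v) hX hx _)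
  rw [Connection.coordCommutator, key, key, ← Finset.sum_sub_distrib]
  refine Finset.sum_congr rfl fun i _ ↦ ?_
  rw [mvfderiv_mvfderiv_coordField_comm hU hx hUs (hc i) u v, Connection.coordCommutator]
  module

variable [ContMDiffVectorBundle ∞ F W I] [FiniteDimensional ℝ F]

lemma Connection.coordCommutator_congr [FiniteDimensional ℝ E] [I.Boundaryless]
    (D : Connection I F W) {x₀ : M}
    {U : Set M} (hUs : U ⊆ (chartAt H x₀).source) {X X' : Π x : M, W x}
    (hX : IsLocalSection I F X U) (hX' : IsLocalSection I F X' U) {x : M} (hx : x ∈ U)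
    (h : X x = X' x) (u v : E) :
    D.coordCommutator x₀ u v X x = D.coordCommutator x₀ u v X' x := by
  have : ContMDiffVectorBundle 1 F W I := .of_le (n := ∞) (by norm_cast)
  let e := trivializationAt F W x
  let b := Module.finBasis ℝ F
  let N := U ∩ e.baseSet
  have hN : IsOpen N := hX.isOpen.inter e.open_baseSet
  have hxN : x ∈ N := ⟨hx, mem_baseSet_trivializationAt' x⟩
  have hs (i) : IsLocalSection I F (e.localFrame b i) N :=
    ⟨hN, (e.contMDiffOn_localFrame_baseSet ∞ b i).mono inter_subset_right⟩
  have hS (v : E) := (isLocalSection_coordField (I := I) x₀ v).mono hN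
    (inter_subset_left.trans hUs)
  have expand {X : Π x : M, W x} (hX : IsLocalSection I F X U) :
      D.coordCommutator x₀ u v X x = ∑ i, e.localFrameCoeff I b i x (X x) •
        D.coordCommutator x₀ u v (e.localFrame b i) x := by
    have hXN := hX.mono hN inter_subset_left
    have hc (i) : ContMDiffOn I 𝓘(ℝ, ℝ) ∞ (fun z ↦ e.localFrameCoeff I b i z (X z)) N :=
      contMDiffOn_localFrameCoeff b hN inter_subset_right hXN.smooth i
    have hsum := IsLocalSection.sum_smul (s := Finset.univ) hN hc hs
    have heq : ∀ z ∈ N, X z = ∑ i, e.localFrameCoeff I b i z (X z) • e.localFrame b i z :=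
      fun z hz ↦ e.eq_sum_localFrameCoeff_smul hz.2
    have hd (w : E) : ∀ z ∈ N, D.deriv (coordField I x₀ w) X z = D.deriv (coordField I x₀ w)
        (fun z ↦ ∑ i, e.localFrameCoeff I b i z (X z) • e.localFrame b i z) z :=
      fun z hz ↦ D.deriv_congr hz _ hXN hsum heq
    rw [← D.coordCommutator_sum_smul hN (inter_subset_left.trans hUs) hc hs hxN,
      Connection.coordCommutator, Connection.coordCommutator,
      D.deriv_congr hxN _ (hXN.deriv (hS v)) (hsum.deriv (hS v)) (hd v),
      D.deriv_congr hxN _ (hXN.deriv (hS u)) (hsum.deriv (hS u)) (hd u)]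
  rw [expand hX, expand hX', h]

/-- The curvature tensor on coordinate vector fields. -/
theorem Connection.curvature_coordField [FiniteDimensional ℝ E] [I.Boundaryless]
    (D : Connection I F W) {x₀ : M}
    {U : Set M} (hUs : U ⊆ (chartAt H x₀).source) {X : Π x : M, W x}
    (hX : IsLocalSection I F X U) {x : M} (hx : x ∈ U) (u v : E) :
    D.curvature x (coordField I x₀ u x) (coordField I x₀ v x) (X x) =
      D.coordCommutator x₀ u v X x := by
  let N := U ∩ (trivializationAt F W x).baseSet
  have hN : IsOpen N := hX.isOpen.inter (Trivialization.open_baseSet _)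
  have hxN : x ∈ N := ⟨hx, mem_baseSet_trivializationAt' x⟩
  have hext : IsLocalSection I F (extend F (X x)) N :=
    (isLocalSection_extend (X x)).mono hN inter_subset_right
  have hmd (w : E) := (isLocalSection_coordField (I := I) x₀ w).mdifferentiableAt (hUs hx)
  change D.curvatureFields (extend E (coordField I x₀ u x)) (extend E (coordField I x₀ v x))
    (extend F (X x)) x = _
  rw [D.curvatureFields_congr_fields hxN hext (mdifferentiableAt_extend ..) (hmd u)
    (mdifferentiableAt_extend ..) (hmd v) (by simp) (by simp),
    D.curvatureFields_coordField (hUs hx),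
    D.coordCommutator_congr (inter_subset_left.trans hUs) hext (hX.mono hN inter_subset_left)
      hxN (by simp)]

end Curvature

section Frames

variable {E : Type*} [NormedAddCommGroup E] [NormedSpace ℝ E]
  {H : Type*} [TopologicalSpace H] {I : ModelWithCorners ℝ E H}
  {M : Type*} [TopologicalSpace M] [ChartedSpace H M] [IsManifold I ∞ M]
  {F : Type*} [NormedAddCommGroup F] [NormedSpace ℝ F]
  {W : M → Type*} [TopologicalSpace (TotalSpace F W)]
  [∀ x, AddCommGroup (W x)] [∀ x, Module ℝ (W x)]
  [∀ x, TopologicalSpace (W x)]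
  [∀ x, IsTopologicalAddGroup (W x)] [∀ x, ContinuousSMul ℝ (W x)]
  [FiberBundle F W] [VectorBundle ℝ F W]

variable [ContMDiffVectorBundle ∞ F W I]

lemma IsLocalSection.contMDiffOn_trivializationAt {Z : Π x : M, W x} {O : Set M}
    (hZ : IsLocalSection I F Z O) (x : M) :
    ContMDiffOn I 𝓘(ℝ, F) ∞ (fun z ↦ (trivializationAt F W x ⟨z, Z z⟩).2)
      (O ∩ (trivializationAt F W x).baseSet) := fun z hz ↦
  ((trivializationAt F W x).contMDiffWithinAt_section _ hz.2).1
    ((hZ.smooth.mono inter_subset_left) z hz)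

/-- A local section that has zeros in all nonempty open subsets vanishes. -/
lemma IsLocalSection.eq_zero_of_dense {Z : Π x : M, W x} {U : Set M}
    (hZ : IsLocalSection I F Z U)
    (h : ∀ O ⊆ U, IsOpen O → O.Nonempty → ∃ y ∈ O, Z y = 0) {x : M} (hx : x ∈ U) : Z x = 0 := by
  let e := trivializationAt F W x
  have hxe : x ∈ e.baseSet := mem_baseSet_trivializationAt' x
  have hcont := (hZ.contMDiffOn_trivializationAt x).continuousOn
  have hopen := hcont.isOpen_inter_preimage (hZ.isOpen.inter e.open_baseSet)
    (isOpen_compl_singleton (x := (0 : F)))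
  by_contra hne
  have hx0 : (e ⟨x, Z x⟩).2 ≠ 0 := fun h0 ↦
    hne ((e.linearEquivAt ℝ x hxe).map_eq_zero_iff.1 h0)
  obtain ⟨y, hy, hy0⟩ := h _ (fun z hz ↦ hz.1.1) hopen ⟨x, ⟨hx, hxe⟩, hx0⟩
  refine hy.2 ?_
  have hye : y ∈ e.baseSet := hy.1.2
  exact (e.linearEquivAt ℝ y hye).map_eq_zero_iff.2 hy0

variable [FiniteDimensional ℝ F]

/-- Smooth sections that are linearly independent at a point have smooth dual functionals near
that point. -/
theorem exists_dualFrame {m : ℕ} {X : Fin m → Π x : M, W x} {U : Set M} (hU : IsOpen U)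
    (hX : ∀ i, IsLocalSection I F (X i) U) {x : M} (hx : x ∈ U)
    (hli : LinearIndependent ℝ fun i ↦ X i x) :
    ∃ U' ⊆ U, IsOpen U' ∧ x ∈ U' ∧ ∃ c : Fin m → Π z : M, W z →ₗ[ℝ] ℝ,
      (∀ z ∈ U', ∀ i j, c i z (X j z) = if i = j then 1 else 0) ∧
      ∀ (Z : Π z : M, W z) (O : Set M), IsLocalSection I F Z O → ∀ i,
        ContMDiffOn I 𝓘(ℝ, ℝ) ∞ (fun z ↦ c i z (Z z)) (U' ∩ O) := by
  classical
  let e := trivializationAt F W x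
  have hxe : x ∈ e.baseSet := mem_baseSet_trivializationAt' x
  let ξ (j : Fin m) (z : M) : F := (e ⟨z, X j z⟩).2
  have hξ : LinearIndependent ℝ fun j ↦ ξ j x :=
    hli.map' (e.linearEquivAt ℝ x hxe).toLinearMap (LinearEquiv.ker _)
  obtain ⟨P₀, hP₀⟩ := (Fintype.linearCombination ℝ fun j ↦ ξ j x).exists_leftInverse_of_injective
    (LinearMap.ker_eq_bot.2 hξ.fintypeLinearCombination_injective)
  let P : F →L[ℝ] (Fin m → ℝ) := LinearMap.toContinuousLinearMap P₀
  have hP (j : Fin m) : P (ξ j x) = Pi.single j 1 := by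
    have := LinearMap.congr_fun hP₀ (Pi.single j 1)
    rw [LinearMap.comp_apply, Fintype.linearCombination_apply_single, one_smul] at this
    exact this
  let T (z : M) : (Fin m → ℝ) →L[ℝ] (Fin m → ℝ) :=
    ∑ j, (ContinuousLinearMap.proj (R := ℝ) (φ := fun _ : Fin m ↦ ℝ) j).smulRight (P (ξ j z))
  have hTsingle (z : M) (j : Fin m) : T z (Pi.single j 1) = P (ξ j z) := by
    simp [T, Pi.single_apply]
  have hTx : T x = 1 := by
    refine ContinuousLinearMap.coe_injective (LinearMap.pi_ext' fun j ↦ LinearMap.ext_ring ?_)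
    exact (hTsingle x j).trans (hP j)
  let N := U ∩ e.baseSet
  have hN : IsOpen N := hU.inter e.open_baseSet
  have hT : ContMDiffOn I 𝓘(ℝ, (Fin m → ℝ) →L[ℝ] (Fin m → ℝ)) ∞ T N := by
    refine contMDiffOn_finsetSum fun j _ ↦ ?_
    exact ((ContinuousLinearMap.smulRightL ℝ (Fin m → ℝ) (Fin m → ℝ)
      (ContinuousLinearMap.proj (R := ℝ) (φ := fun _ : Fin m ↦ ℝ) j)).comp P).contMDiff
      |>.comp_contMDiffOn ((hX j).contMDiffOn_trivializationAt x)
  let U' := N ∩ T ⁻¹' {A | IsUnit A}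
  have hU' : IsOpen U' := hT.continuousOn.isOpen_inter_preimage hN Units.isOpen
  have hxU' : x ∈ U' := ⟨⟨hx, hxe⟩, by simp [hTx]⟩
  let c (i : Fin m) (z : M) : W z →ₗ[ℝ] ℝ :=
    (LinearMap.proj i) ∘ₗ (Ring.inverse (T z)).toLinearMap ∘ₗ P.toLinearMap ∘ₗ e.linearMapAt ℝ z
  have hc (i : Fin m) (z : M) (hz : z ∈ U') (w : W z) :
      c i z w = Ring.inverse (T z) (P (e ⟨z, w⟩).2) i := by
    simp only [c, LinearMap.comp_apply, e.coe_linearMapAt_of_mem hz.1.2]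
    rfl
  refine ⟨U', fun z hz ↦ hz.1.1, hU', hxU', c, fun z hz i j ↦ ?_, fun Z O hZ i ↦ ?_⟩
  · rw [hc i z hz]
    have h1 : Ring.inverse (T z) (T z (Pi.single j 1)) = Pi.single j 1 :=
      congrArg (fun A : (Fin m → ℝ) →L[ℝ] (Fin m → ℝ) ↦ A (Pi.single j 1))
        (Ring.inverse_mul_cancel _ hz.2)
    change Ring.inverse (T z) (P (ξ j z)) i = _
    rw [← hTsingle, h1, Pi.single_apply]
  · have h1 : ContMDiffOn I 𝓘(ℝ, (Fin m → ℝ) →L[ℝ] (Fin m → ℝ)) ∞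
        (fun z ↦ Ring.inverse (T z)) (U' ∩ O) := by
      intro z hz
      obtain ⟨A, hA⟩ := hz.1.2
      have h2 : ContMDiffAt 𝓘(ℝ, (Fin m → ℝ) →L[ℝ] (Fin m → ℝ))
          𝓘(ℝ, (Fin m → ℝ) →L[ℝ] (Fin m → ℝ)) ∞ Ring.inverse (T z) := by
        rw [← hA]
        exact (contDiffAt_ringInverse ℝ A).contMDiffAt
      exact (h2.comp z (hT.contMDiffAt (hN.mem_nhds hz.1.1))).contMDiffWithinAt
    have h3 : ContMDiffOn I 𝓘(ℝ, Fin m → ℝ) ∞ (fun z ↦ P (e ⟨z, Z z⟩).2) (U' ∩ O) :=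
      P.contMDiff.comp_contMDiffOn
        ((hZ.contMDiffOn_trivializationAt x).mono fun z hz ↦ ⟨hz.2, hz.1.1.2⟩)
    have h4 := (ContinuousLinearMap.proj (R := ℝ) (φ := fun _ : Fin m ↦ ℝ) i).contMDiff
      (n := ∞) |>.comp_contMDiffOn (h1.clm_apply h3)
    exact h4.congr fun z hz ↦ hc i z hz.1 _

lemma linearIndependent_of_dual {m : ℕ} {V : Type*} [AddCommGroup V] [Module ℝ V]
    {w : Fin m → V} {c : Fin m → V →ₗ[ℝ] ℝ} (h : ∀ i j, c i (w j) = if i = j then 1 else 0) :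
    LinearIndependent ℝ w := by
  refine Fintype.linearIndependent_iff.2 fun g hg i ↦ ?_
  have := congrArg (c i) hg
  simpa [h] using this

lemma sum_dual_smul {m : ℕ} {V : Type*} [AddCommGroup V] [Module ℝ V]
    {w : Fin m → V} {c : Fin m → V →ₗ[ℝ] ℝ} (h : ∀ i j, c i (w j) = if i = j then 1 else 0)
    {v : V} (hv : v ∈ Submodule.span ℝ (range w)) : ∑ i, c i v • w i = v := by
  obtain ⟨g, rfl⟩ := (Submodule.mem_span_range_iff_exists_fun ℝ).1 hv
  simp [h]

/-- The family `V` of subspaces has a smooth frame near `x`. -/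
def IsFramedAt (I : ModelWithCorners ℝ E H) (F : Type*) [NormedAddCommGroup F] [NormedSpace ℝ F]
    {W : M → Type*} [TopologicalSpace (TotalSpace F W)]
    [∀ x, AddCommGroup (W x)] [∀ x, Module ℝ (W x)] [∀ x, TopologicalSpace (W x)]
    [FiberBundle F W] (V : Π x : M, Submodule ℝ (W x)) (x : M) : Prop :=
  ∃ (n : ℕ) (U : Set M) (X : Fin n → Π y : M, W y), IsOpen U ∧ x ∈ U ∧
    (∀ i, IsLocalSection I F (X i) U) ∧
    ∀ y ∈ U, LinearIndependent ℝ (fun i ↦ X i y) ∧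
      Submodule.span ℝ (range fun i ↦ X i y) = V y

lemma IsFramedAt.exists_isOpen {V : Π x : M, Submodule ℝ (W x)} {x : M}
    (h : IsFramedAt I F V x) : ∃ (n : ℕ) (U : Set M), IsOpen U ∧ x ∈ U ∧ ∀ y ∈ U,
      IsFramedAt I F V y ∧ Module.finrank ℝ (V y) = n := by
  obtain ⟨n, U, X, hU, hx, hX, h⟩ := h
  refine ⟨n, U, hU, hx, fun y hy ↦ ⟨⟨n, U, X, hU, hy, hX, h⟩, ?_⟩⟩
  rw [← (h y hy).2, finrank_span_eq_card (h y hy).1, Fintype.card_fin]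

/-- Near a point where `V` has a smooth frame, the second fundamental form of `V` is tensorial. -/
lemma Connection.toFun_mem_of_isFramedAt (D : Connection I F W) {V : Π x : M, Submodule ℝ (W x)}
    {x : M} (hV : IsFramedAt I F V x) {Z : Π x : M, W x} {U : Set M} (hZ : IsLocalSection I F Z U)
    (hZV : TakesValuesIn V Z U) (hx : x ∈ U) (h0 : Z x = 0) (v : TangentSpace I x) :
    D.toFun Z x v ∈ V x := by
  obtain ⟨n, U₁, X, hU₁, hx₁, hX, hspan⟩ := hV
  obtain ⟨U₂, hU₂₁, hU₂, hx₂, c, hc, hcs⟩ := exists_dualFrame hU₁ hX hx₁ (hspan x hx₁).1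
  let N := U₂ ∩ U
  have hN : IsOpen N := hU₂.inter hZ.isOpen
  have hXN (i) := (hX i).mono hN (inter_subset_left.trans hU₂₁)
  have hcN (i) : ContMDiffOn I 𝓘(ℝ, ℝ) ∞ (fun z ↦ c i z (Z z)) N := hcs Z U hZ i
  have heq : ∀ z ∈ N, Z z = ∑ i, c i z (Z z) • X i z := fun z hz ↦ by
    refine (sum_dual_smul (w := fun i ↦ X i z) (c := fun i ↦ c i z) (hc z hz.1) ?_).symm
    rw [(hspan z (hU₂₁ hz.1)).2]
    exact hZV z hz.2
  rw [D.toFun_congr (U := N) ⟨hx₂, hx⟩ (hZ.mono hN inter_subset_right)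
    (IsLocalSection.sum_smul hN hcN hXN) heq, D.toFun_sum_smul hN hcN hXN ⟨hx₂, hx⟩]
  refine Submodule.sum_mem _ fun i _ ↦ ?_
  rw [h0, map_zero, zero_smul, zero_add, ← (hspan x hx₁).2]
  exact Submodule.smul_mem _ _ (Submodule.subset_span (mem_range_self i))

end Frames

section FlagProperties

variable {E : Type*} [NormedAddCommGroup E] [NormedSpace ℝ E]
  {H : Type*} [TopologicalSpace H] {I : ModelWithCorners ℝ E H}
  {M : Type*} [TopologicalSpace M] [ChartedSpace H M] [IsManifold I ∞ M]
  {F : Type*} [NormedAddCommGroup F] [NormedSpace ℝ F]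
  {W : M → Type*} [TopologicalSpace (TotalSpace F W)]
  [∀ x, AddCommGroup (W x)] [∀ x, Module ℝ (W x)]
  [∀ x, TopologicalSpace (W x)]
  [∀ x, IsTopologicalAddGroup (W x)] [∀ x, ContinuousSMul ℝ (W x)]
  [FiberBundle F W] [VectorBundle ℝ F W]

  [ContMDiffVectorBundle ∞ F W I]

lemma smoothPart_le (V : Π x : M, Submodule ℝ (W x)) (x : M) : smoothPart I F V x ≤ V x := by
  rintro _ ⟨U, X, hx, -, hV, rfl⟩
  exact hV x hx

lemma TakesValuesIn.smoothPart {V : Π x : M, Submodule ℝ (W x)} {X : Π x : M, W x} {U : Set M}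
    (hV : TakesValuesIn V X U) (hX : IsLocalSection I F X U) :
    TakesValuesIn (smoothPart I F V) X U :=
  fun _ hy ↦ ⟨U, X, hy, hX, hV, rfl⟩

lemma smoothPart_mono_of_isOpen {V V' : Π x : M, Submodule ℝ (W x)} {O : Set M} (hO : IsOpen O)
    (h : ∀ y ∈ O, V y ≤ V' y) {x : M} (hx : x ∈ O) :
    smoothPart I F V x ≤ smoothPart I F V' x := by
  rintro _ ⟨U, X, hxU, hX, hV, rfl⟩
  exact ⟨U ∩ O, X, ⟨hxU, hx⟩, hX.mono (hX.isOpen.inter hO) inter_subset_left,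
    fun y hy ↦ h y hy.2 (hV y hy.1), rfl⟩

lemma le_smoothPart_smoothPart (V : Π x : M, Submodule ℝ (W x)) (x : M) :
    smoothPart I F V x ≤ smoothPart I F (smoothPart I F V) x := by
  rintro _ ⟨U, X, hxU, hX, hV, rfl⟩
  exact (hV.smoothPart hX).smoothPart hX x hxU

lemma Connection.mem_curvatureKernel {D : Connection I F W} {x : M} {w : W x} :
    w ∈ D.curvatureKernel x ↔ ∀ u v, D.curvature x u v w = 0 := by
  simp only [Connection.curvatureKernel, Submodule.mem_iInf, LinearMap.mem_ker]
  rfl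

lemma Connection.mem_secondFundamentalKernel {D : Connection I F W}
    {V : Π x : M, Submodule ℝ (W x)} {x : M} {w : W x} :
    w ∈ D.secondFundamentalKernel V x ↔ ∃ (U : Set M) (X : Π y : M, W y), x ∈ U ∧
      IsLocalSection I F X U ∧ TakesValuesIn V X U ∧ X x = w ∧ ∀ v, D.toFun X x v ∈ V x := by
  change D.SecondFundamentalForm V x w 0 ↔ _
  have key (X : Π y : M, W y) : (0 : TangentSpace I x →ₗ[ℝ] W x ⧸ V x) =
      (V x).mkQ ∘ₗ (D.toFun X x).toLinearMap ↔ ∀ v, D.toFun X x v ∈ V x := by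
    rw [eq_comm, LinearMap.ext_iff]
    exact forall_congr' fun v ↦ Submodule.Quotient.mk_eq_zero (V x)
  simp only [Connection.SecondFundamentalForm, key]

lemma Connection.secondFundamentalKernel_le (D : Connection I F W)
    (V : Π x : M, Submodule ℝ (W x)) (x : M) : D.secondFundamentalKernel V x ≤ V x := by
  intro w hw
  obtain ⟨U, X, hx, -, hV, rfl, -⟩ := mem_secondFundamentalKernel.1 hw
  exact hV x hx

lemma Connection.secondFundamentalKernel_mono_of_isOpen (D : Connection I F W)
    {V V' : Π x : M, Submodule ℝ (W x)} {O : Set M} (hO : IsOpen O)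
    (h : ∀ y ∈ O, V y ≤ V' y) {x : M} (hx : x ∈ O) :
    D.secondFundamentalKernel V x ≤ D.secondFundamentalKernel V' x := by
  intro w hw
  obtain ⟨U, X, hxU, hX, hV, rfl, hd⟩ := mem_secondFundamentalKernel.1 hw
  exact mem_secondFundamentalKernel.2 ⟨U ∩ O, X, ⟨hxU, hx⟩,
    hX.mono (hX.isOpen.inter hO) inter_subset_left,
    fun y hy ↦ h y hy.2 (hV y hy.1), rfl, fun v ↦ h x hx (hd v)⟩

lemma Connection.derivedFlag_succ_le (D : Connection I F W) (i : ℕ) (x : M) :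
    D.derivedFlag (i + 1) x ≤ D.derivedFlag i x :=
  (smoothPart_le _ x).trans (D.secondFundamentalKernel_le _ x)

lemma Connection.derivedFlag_anti (D : Connection I F W) {i j : ℕ} (h : i ≤ j) (x : M) :
    D.derivedFlag j x ≤ D.derivedFlag i x :=
  antitone_nat_of_succ_le (f := fun i ↦ D.derivedFlag i x) (fun i ↦ D.derivedFlag_succ_le i x) h

lemma Connection.derivedFlag_le_smoothPart (D : Connection I F W) (i : ℕ) (x : M) :
    D.derivedFlag i x ≤ smoothPart I F (D.derivedFlag i) x := by
  cases i <;> exact le_smoothPart_smoothPart _ x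

lemma Connection.derivedFlag_stable (D : Connection I F W) {O : Set M} (hO : IsOpen O) {i : ℕ}
    (h : ∀ y ∈ O, D.derivedFlag i y ≤ D.derivedFlag (i + 1) y) {j : ℕ} (hij : i ≤ j) :
    ∀ y ∈ O, D.derivedFlag i y ≤ D.derivedFlag j y := by
  have hstep : ∀ j, i ≤ j → ∀ y ∈ O, D.derivedFlag j y ≤ D.derivedFlag (j + 1) y := by
    intro j hj
    induction j, hj using Nat.le_induction with
    | base => exact h
    | succ j _ ih =>
      exact fun y hy ↦ smoothPart_mono_of_isOpen hO
        (fun z hz ↦ D.secondFundamentalKernel_mono_of_isOpen hO ih hz) hy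
  induction j, hij using Nat.le_induction with
  | base => exact fun y _ ↦ le_rfl
  | succ j hj ih => exact fun y hy ↦ (ih y hy).trans (hstep j hj y hy)

/-- A family `V` of subspaces is smoothly closed if every local section whose values lie in `V` on
a dense set takes all its values in `V`. -/
def SmoothlyClosed (I : ModelWithCorners ℝ E H) (F : Type*) [NormedAddCommGroup F]
    [NormedSpace ℝ F] {W : M → Type*} [TopologicalSpace (TotalSpace F W)]
    [∀ x, AddCommGroup (W x)] [∀ x, Module ℝ (W x)] [∀ x, TopologicalSpace (W x)]
    [FiberBundle F W] (V : Π x : M, Submodule ℝ (W x)) : Prop :=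
  ∀ (U : Set M) (X : Π x : M, W x), IsLocalSection I F X U →
    (∀ O ⊆ U, IsOpen O → O.Nonempty → ∃ y ∈ O, X y ∈ V y) → TakesValuesIn V X U

lemma SmoothlyClosed.smoothPart {V : Π x : M, Submodule ℝ (W x)} (h : SmoothlyClosed I F V) :
    SmoothlyClosed I F (smoothPart I F V) := fun U X hX hd ↦
  (h U X hX fun O hOU hO hne ↦ (hd O hOU hO hne).imp
    fun y hy ↦ ⟨hy.1, smoothPart_le V y hy.2⟩).smoothPart hX

variable [FiniteDimensional ℝ F]

lemma finrank_submodule_fiber_le (V : Π x : M, Submodule ℝ (W x)) (x : M) :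
    Module.finrank ℝ (V x) ≤ Module.finrank ℝ F := by
  have := VectorBundle.finiteDimensional ℝ F W x
  rw [← VectorBundle.finrank_eq ℝ F W x]
  exact Submodule.finrank_le _

/-- If `S(V) = V`, then `V` has smooth frames near the points of a dense set. -/
theorem exists_isFramedAt {V : Π x : M, Submodule ℝ (W x)}
    (hV : ∀ x, V x ≤ smoothPart I F V x) {O : Set M} (hO : IsOpen O) (hne : O.Nonempty) :
    ∃ y ∈ O, IsFramedAt I F V y := by
  have hfin (x : M) := VectorBundle.finiteDimensional ℝ F W x
  have hbdd : BddAbove ((fun y ↦ Module.finrank ℝ (V y)) '' O) := by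
    refine ⟨Module.finrank ℝ F, ?_⟩
    rintro _ ⟨y, -, rfl⟩
    exact finrank_submodule_fiber_le V y
  obtain ⟨y, hy, hmax⟩ := Nat.sSup_mem (hne.image _) hbdd
  let b := Module.finBasis ℝ (V y)
  choose U X hyU hX hXV hXb using fun i ↦ hV y (b i).2
  have hN : IsOpen (O ∩ ⋂ i, U i) :=
    hO.inter (isOpen_iInter_of_finite fun i ↦ (hX i).isOpen)
  have hyN : y ∈ O ∩ ⋂ i, U i := ⟨hy, mem_iInter.2 hyU⟩
  have hXN (i) := (hX i).mono hN (inter_subset_right.trans (iInter_subset U i))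
  have hli : LinearIndependent ℝ fun i ↦ X i y := by
    simp only [hXb]
    exact b.linearIndependent.map' (V y).subtype (Submodule.ker_subtype _)
  obtain ⟨U', hU'N, hU', hyU', c, hc, -⟩ := exists_dualFrame hN hXN hyN hli
  refine ⟨y, hy, _, U', X, hU', hyU', fun i ↦ (hXN i).mono hU' hU'N, fun z hz ↦ ?_⟩
  have hliz : LinearIndependent ℝ fun i ↦ X i z :=
    linearIndependent_of_dual (c := fun i ↦ c i z) (hc z hz)
  refine ⟨hliz, Submodule.eq_of_le_of_finrank_le (Submodule.span_le.2 ?_) ?_⟩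
  · rintro _ ⟨i, rfl⟩
    exact hXV i z (mem_iInter.1 (hU'N hz).2 i)
  · rw [finrank_span_eq_card hliz, Fintype.card_fin, show Module.finrank ℝ (V y) = _ from hmax]
    exact le_csSup hbdd (mem_image_of_mem _ (hU'N hz).1)

variable [FiniteDimensional ℝ E] [I.Boundaryless]

lemma Connection.smoothlyClosed_curvatureKernel (D : Connection I F W) :
    SmoothlyClosed I F D.curvatureKernel := by
  intro U X hX hd x hx
  have := FiniteDimensional.complete ℝ E
  have hN : IsOpen (U ∩ (chartAt H x).source) := hX.isOpen.inter (chartAt H x).open_source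
  have hXN := hX.mono hN inter_subset_left
  have hxN : x ∈ U ∩ (chartAt H x).source := ⟨hx, mem_chart_source H x⟩
  refine mem_curvatureKernel.2 fun u v ↦ ?_
  obtain ⟨u, rfl⟩ := exists_coordField_eq hxN.2 u
  obtain ⟨v, rfl⟩ := exists_coordField_eq hxN.2 v
  rw [D.curvature_coordField inter_subset_right hXN hxN]
  refine (hXN.coordCommutator (D := D) inter_subset_right u v).eq_zero_of_dense
    (fun O hON hO hne ↦ ?_) hxN
  obtain ⟨y, hy, hyk⟩ := hd O (hON.trans inter_subset_left) hO hne
  refine ⟨y, hy, ?_⟩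
  rw [← D.curvature_coordField inter_subset_right hXN (hON hy)]
  exact mem_curvatureKernel.1 hyk _ _

/-- A local section with values in the kernel of the second fundamental form of `V` on a dense set
has its covariant derivatives in `V`. -/
theorem Connection.toFun_mem_of_dense (D : Connection I F W) {V : Π x : M, Submodule ℝ (W x)}
    (hV : SmoothlyClosed I F V) (hV' : ∀ x, V x ≤ DerivedFlag.smoothPart I F V x)
    {X : Π x : M, W x} {U : Set M}
    (hX : IsLocalSection I F X U)
    (hd : ∀ O ⊆ U, IsOpen O → O.Nonempty → ∃ y ∈ O, X y ∈ D.secondFundamentalKernel V y)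
    {x : M} (hx : x ∈ U) (v : TangentSpace I x) : D.toFun X x v ∈ V x := by
  have hXV : TakesValuesIn V X U := hV U X hX fun O hOU hO hne ↦
    (hd O hOU hO hne).imp fun y hy ↦ ⟨hy.1, D.secondFundamentalKernel_le V y hy.2⟩
  have hN : IsOpen (U ∩ (chartAt H x).source) := hX.isOpen.inter (chartAt H x).open_source
  have hXN := hX.mono hN inter_subset_left
  have hxN : x ∈ U ∩ (chartAt H x).source := ⟨hx, mem_chart_source H x⟩
  obtain ⟨v, rfl⟩ := exists_coordField_eq hxN.2 v
  refine hV _ _ (hXN.deriv (D := D) ((isLocalSection_coordField x v).mono hN inter_subset_right))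
    (fun O hON hO hne ↦ ?_) x hxN
  obtain ⟨y₁, hy₁, hfr⟩ := exists_isFramedAt hV' hO hne
  obtain ⟨_, O₁, hO₁, hy₁O₁, hfr₁⟩ := hfr.exists_isOpen
  obtain ⟨y, hy, hyK⟩ := hd (O ∩ O₁) (inter_subset_left.trans (hON.trans inter_subset_left))
    (hO.inter hO₁) ⟨y₁, hy₁, hy₁O₁⟩
  refine ⟨y, hy.1, ?_⟩
  have hyU : y ∈ U := (hON hy.1).1
  obtain ⟨U', X', hyU', hX', hX'V, hXX', hX'd⟩ := mem_secondFundamentalKernel.1 hyK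
  have hUU' : IsOpen (U ∩ U') := hX.isOpen.inter hX'.isOpen
  have hXUU' := hX.mono hUU' inter_subset_left
  have hX'UU' := hX'.mono hUU' inter_subset_right
  have h1 := D.toFun_mem_of_isFramedAt (hfr₁ y hy.2).1 (hXUU'.sub hX'UU')
    (fun z hz ↦ (V z).sub_mem (hXV z hz.1) (hX'V z hz.2)) ⟨hyU, hyU'⟩
    (by simp [hXX']) (coordField I x v y)
  rw [D.toFun_sub (U := U ∩ U') ⟨hyU, hyU'⟩ hXUU' hX'UU', _root_.sub_apply] at h1
  exact ((V y).sub_mem_iff_left (hX'd _)).1 h1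

lemma Connection.smoothlyClosed_secondFundamentalKernel (D : Connection I F W)
    {V : Π x : M, Submodule ℝ (W x)} (hV : SmoothlyClosed I F V)
    (hV' : ∀ x, V x ≤ DerivedFlag.smoothPart I F V x) :
    SmoothlyClosed I F (D.secondFundamentalKernel V) := fun U X hX hd _ hx ↦
  mem_secondFundamentalKernel.2 ⟨U, X, hx, hX, hV U X hX fun O hOU hO hne ↦
    (hd O hOU hO hne).imp fun y hy ↦ ⟨hy.1, D.secondFundamentalKernel_le V y hy.2⟩, rfl,
    D.toFun_mem_of_dense hV hV' hX hd hx⟩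

lemma Connection.smoothlyClosed_derivedFlag (D : Connection I F W) (i : ℕ) :
    SmoothlyClosed I F (D.derivedFlag i) := by
  induction i with
  | zero => exact D.smoothlyClosed_curvatureKernel.smoothPart
  | succ i ih =>
    exact (D.smoothlyClosed_secondFundamentalKernel ih (D.derivedFlag_le_smoothPart i)).smoothPart

/-- On a suitable nonempty open subset of any given one the derived flag either becomes stationary
before step `j` or has lost at least `j` dimensions by then. -/
lemma Connection.derivedFlag_dichotomy (D : Connection I F W) (j : ℕ) {O : Set M} (hO : IsOpen O)
    (hne : O.Nonempty) : ∃ O' ⊆ O, IsOpen O' ∧ O'.Nonempty ∧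
      ((∃ i < j, ∀ y ∈ O', D.derivedFlag i y ≤ D.derivedFlag (i + 1) y) ∨
        ∀ y ∈ O', Module.finrank ℝ (D.derivedFlag j y) + j ≤ Module.finrank ℝ F) := by
  have hfin (x : M) := VectorBundle.finiteDimensional ℝ F W x
  induction j with
  | zero => exact ⟨O, subset_rfl, hO, hne, .inr fun y _ ↦ finrank_submodule_fiber_le _ y⟩
  | succ j ih =>
    obtain ⟨O', hO'O, hO', hne', ⟨i, hij, hi⟩ | hr⟩ := ih
    · exact ⟨O', hO'O, hO', hne', .inl ⟨i, hij.trans j.lt_succ_self, hi⟩⟩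
    obtain ⟨y, hy, hfr⟩ := exists_isFramedAt (D.derivedFlag_le_smoothPart j) hO' hne'
    obtain ⟨a, O₁, hO₁, hyO₁, ha⟩ := hfr.exists_isOpen
    obtain ⟨z, hz, hfr'⟩ := exists_isFramedAt (D.derivedFlag_le_smoothPart (j + 1))
      (hO'.inter hO₁) ⟨y, hy, hyO₁⟩
    obtain ⟨b, O₂, hO₂, hzO₂, hb⟩ := hfr'.exists_isOpen
    refine ⟨O' ∩ O₁ ∩ O₂, fun w hw ↦ hO'O hw.1.1, (hO'.inter hO₁).inter hO₂, ⟨z, hz, hzO₂⟩, ?_⟩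
    by_cases hab : a ≤ b
    · refine .inl ⟨j, j.lt_succ_self, fun w hw ↦ ?_⟩
      exact (Submodule.eq_of_le_of_finrank_le (D.derivedFlag_succ_le j w)
        (by rw [(ha w hw.1.2).2, (hb w hw.2).2]; exact hab)).ge
    · refine .inr fun w hw ↦ ?_
      have := hr w hw.1.1
      rw [(ha w hw.1.2).2] at this
      rw [(hb w hw.2).2]
      omega

/-- The derived flag is stationary after `rank W` steps. -/
theorem Connection.derivedFlag_le_of_finrank (D : Connection I F W) (m : ℕ) (x : M) :
    D.derivedFlag (Module.finrank ℝ F) x ≤ D.derivedFlag m x := by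
  intro w hw
  obtain ⟨U, X, hx, hX, hXV, rfl⟩ := D.derivedFlag_le_smoothPart _ x hw
  refine D.smoothlyClosed_derivedFlag m U X hX (fun O hOU hO hne ↦ ?_) x hx
  obtain ⟨O', hO'O, hO', ⟨y, hy⟩, ⟨i, hi, hst⟩ | hr⟩ :=
    D.derivedFlag_dichotomy (Module.finrank ℝ F + 1) hO hne
  · refine ⟨y, hO'O hy, ?_⟩
    have h1 := D.derivedFlag_anti (Nat.lt_succ_iff.1 hi) y (hXV y (hOU (hO'O hy)))
    rcases le_total m i with hmi | him
    · exact D.derivedFlag_anti hmi y h1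
    · exact D.derivedFlag_stable hO' hst him y hy h1
  · have := hr y hy
    omega

lemma Connection.derivedFlag_eq_terminal (D : Connection I F W) {l : ℕ}
    (hl : Module.finrank ℝ F ≤ l) : D.derivedFlag l = D.terminal :=
  funext fun x ↦ le_antisymm
    (le_iInf fun i ↦ (D.derivedFlag_anti hl x).trans (D.derivedFlag_le_of_finrank i x))
    (iInf_le _ l)

/-- Local parallel sections take values in the terminal subset of the derived flag. -/
theorem Connection.IsParallelOn.takesValuesIn_terminal {D : Connection I F W} {X : Π x : M, W x}
    {U : Set M} (h : D.IsParallelOn X U) : TakesValuesIn D.terminal X U := by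
  obtain ⟨hX, h0⟩ := h
  have := FiniteDimensional.complete ℝ E
  have hker : TakesValuesIn D.curvatureKernel X U := fun x hx ↦ by
    have hN : IsOpen (U ∩ (chartAt H x).source) := hX.isOpen.inter (chartAt H x).open_source
    have hXN := hX.mono hN inter_subset_left
    have hxN : x ∈ U ∩ (chartAt H x).source := ⟨hx, mem_chart_source H x⟩
    refine mem_curvatureKernel.2 fun u v ↦ ?_
    obtain ⟨u, rfl⟩ := exists_coordField_eq hxN.2 u
    obtain ⟨v, rfl⟩ := exists_coordField_eq hxN.2 v
    rw [D.curvature_coordField inter_subset_right hXN hxN]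
    have hzero (u v : E) :
        D.deriv (coordField I x u) (D.deriv (coordField I x v) X) x = 0 := by
      rw [D.deriv_congr (X' := (0 : ℝ) • X) hxN _
        (hXN.deriv ((isLocalSection_coordField x v).mono hN inter_subset_right)) (hXN.smul 0)
        fun y hy ↦ by simp [Connection.deriv, h0 y hy.1], D.deriv_smul hxN 0 _ hXN, zero_smul]
    rw [Connection.coordCommutator, hzero, hzero, sub_zero]
  have hflag (i : ℕ) : TakesValuesIn (D.derivedFlag i) X U := by
    induction i with
    | zero => exact hker.smoothPart hX
    | succ i ih =>
      refine TakesValuesIn.smoothPart (fun x hx ↦ ?_) hX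
      exact mem_secondFundamentalKernel.2 ⟨U, X, hx, hX, ih, rfl, fun v ↦ by simp [h0 x hx]⟩
  exact fun x hx ↦ (Submodule.mem_iInf _).2 fun i ↦ hflag i x hx

/-- The covariant derivative preserves the terminal subset of the derived flag. -/
theorem Connection.toFun_mem_terminal (D : Connection I F W) {X : Π x : M, W x} {U : Set M}
    (hX : IsLocalSection I F X U) (hXV : TakesValuesIn D.terminal X U) {x : M} (hx : x ∈ U)
    (v : TangentSpace I x) : D.toFun X x v ∈ D.terminal x := by
  have h := D.derivedFlag_eq_terminal le_rfl
  rw [← h]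
  refine D.toFun_mem_of_dense (D.smoothlyClosed_derivedFlag _) (D.derivedFlag_le_smoothPart _) hX
    (fun O hOU _ hne ↦ ?_) hx v
  obtain ⟨y, hy⟩ := hne
  exact ⟨y, hy, smoothPart_le _ y
    ((Submodule.mem_iInf _).1 (hXV y (hOU hy)) (Module.finrank ℝ F + 1))⟩

lemma Connection.curvature_eq_zero_of_mem_terminal (D : Connection I F W) {x : M} {w : W x}
    (hw : w ∈ D.terminal x) (u v : TangentSpace I x) : D.curvature x u v w = 0 :=
  mem_curvatureKernel.1 (smoothPart_le _ x ((Submodule.mem_iInf _).1 hw 0)) u v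

end FlagProperties

section ParallelSections

variable {E : Type*} [NormedAddCommGroup E] [NormedSpace ℝ E]
  {H : Type*} [TopologicalSpace H] {I : ModelWithCorners ℝ E H}
  {M : Type*} [TopologicalSpace M] [ChartedSpace H M] [IsManifold I ∞ M]
  {F : Type*} [NormedAddCommGroup F] [NormedSpace ℝ F]
  {W : M → Type*} [TopologicalSpace (TotalSpace F W)]
  [∀ x, AddCommGroup (W x)] [∀ x, Module ℝ (W x)]
  [∀ x, TopologicalSpace (W x)]
  [∀ x, IsTopologicalAddGroup (W x)] [∀ x, ContinuousSMul ℝ (W x)]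
  [FiberBundle F W] [VectorBundle ℝ F W]
  [ContMDiffVectorBundle ∞ F W I] [FiniteDimensional ℝ F] [FiniteDimensional ℝ E] [I.Boundaryless]

lemma Connection.IsParallelOn.mono {D : Connection I F W} {X : Π x : M, W x} {U U' : Set M}
    (h : D.IsParallelOn X U) (hU' : IsOpen U') (hU : U' ⊆ U) : D.IsParallelOn X U' :=
  ⟨h.1.mono hU' hU, fun y hy ↦ h.2 y (hU hy)⟩

/-- The matrix unit with entry `1` in row `i` and column `j`. -/
def matrixUnit {m : ℕ} (i j : Fin m) : (Fin m → ℝ) →L[ℝ] (Fin m → ℝ) :=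
  (ContinuousLinearMap.proj (R := ℝ) (φ := fun _ : Fin m ↦ ℝ) j).smulRight (Pi.single i 1)

/-- The connection matrix of `D` in the frame `X` with dual functionals `c`, as a form with values
in the endomorphisms of `Fin m → ℝ`, in the chart at `x₀`. -/
def Connection.formEntry (D : Connection I F W) (x₀ : M) {m : ℕ} (X : Fin m → Π x : M, W x)
    (c : Fin m → Π z : M, W z →ₗ[ℝ] ℝ) (i j : Fin m) (z : M) : E →L[ℝ] ℝ :=
  LinearMap.toContinuousLinearMap ((c i z) ∘ₗ (D.toFun (X j) z).toLinearMap ∘ₗ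
    ((trivializationAt E (TangentSpace I : M → Type _) x₀).symmL ℝ z).toLinearMap)

/-- The connection form of `D` in the frame `X` with dual functionals `c`, in the chart at `x₀`. -/
def Connection.form (D : Connection I F W) (x₀ : M) {m : ℕ} (X : Fin m → Π x : M, W x)
    (c : Fin m → Π z : M, W z →ₗ[ℝ] ℝ) (z : M) :
    E →L[ℝ] (Fin m → ℝ) →L[ℝ] (Fin m → ℝ) :=
  ∑ i, ∑ j, (D.formEntry x₀ X c i j z).smulRight (matrixUnit i j)

lemma Connection.formEntry_apply (D : Connection I F W) {x₀ : M} {m : ℕ}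
    (X : Fin m → Π x : M, W x) (c : Fin m → Π z : M, W z →ₗ[ℝ] ℝ) (i j : Fin m) {z : M}
    (hz : z ∈ (chartAt H x₀).source) (v : E) :
    D.formEntry x₀ X c i j z v = c i z (D.toFun (X j) z (coordField I x₀ v z)) := by
  rw [coordField_eq_symmL hz]
  rfl

lemma Connection.form_apply (D : Connection I F W) (x₀ : M) {m : ℕ}
    (X : Fin m → Π x : M, W x) (c : Fin m → Π z : M, W z →ₗ[ℝ] ℝ) (z : M) (v : E)
    (f : Fin m → ℝ) (i : Fin m) :
    D.form x₀ X c z v f i = ∑ j, D.formEntry x₀ X c i j z v * f j := by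
  classical
  simp [Connection.form, matrixUnit, Finset.sum_apply, Pi.single_apply]

lemma Connection.contMDiffOn_formEntry (D : Connection I F W) {x₀ : M} {m : ℕ}
    {X : Fin m → Π x : M, W x} {c : Fin m → Π z : M, W z →ₗ[ℝ] ℝ} {N : Set M}
    (hN : IsOpen N) (hNs : N ⊆ (chartAt H x₀).source) (hX : ∀ i, IsLocalSection I F (X i) N)
    (hcs : ∀ Z : Π z : M, W z, IsLocalSection I F Z N → ∀ i,
        ContMDiffOn I 𝓘(ℝ, ℝ) ∞ (fun z ↦ c i z (Z z)) N) (i j : Fin m) :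
    ContMDiffOn I 𝓘(ℝ, E →L[ℝ] ℝ) ∞ (D.formEntry x₀ X c i j) N := by
  intro z hz
  refine ContMDiffAt.contMDiffWithinAt (contMDiffAt_clm fun v ↦ ?_)
  have h := hcs _ ((hX j).deriv (D := D) ((isLocalSection_coordField x₀ v).mono hN hNs)) i
  refine (h.contMDiffAt (hN.mem_nhds hz)).congr_of_eventuallyEq ?_
  filter_upwards [hN.mem_nhds hz] with y hy
  exact D.formEntry_apply X c i j (hNs hy) v

lemma Connection.contMDiffOn_form (D : Connection I F W) {x₀ : M} {m : ℕ}
    {X : Fin m → Π x : M, W x} {c : Fin m → Π z : M, W z →ₗ[ℝ] ℝ} {N : Set M}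
    (hN : IsOpen N) (hNs : N ⊆ (chartAt H x₀).source) (hX : ∀ i, IsLocalSection I F (X i) N)
    (hcs : ∀ Z : Π z : M, W z, IsLocalSection I F Z N → ∀ i,
        ContMDiffOn I 𝓘(ℝ, ℝ) ∞ (fun z ↦ c i z (Z z)) N) :
    ContMDiffOn I 𝓘(ℝ, E →L[ℝ] (Fin m → ℝ) →L[ℝ] (Fin m → ℝ)) ∞ (D.form x₀ X c) N := by
  refine contMDiffOn_finsetSum fun i _ ↦ contMDiffOn_finsetSum fun j _ ↦ ?_
  exact ((ContinuousLinearMap.smulRightL ℝ E ((Fin m → ℝ) →L[ℝ] (Fin m → ℝ))).flip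
    (matrixUnit i j)).contMDiff.comp_contMDiffOn (D.contMDiffOn_formEntry hN hNs hX hcs i j)

lemma Connection.toFun_frame_eq (D : Connection I F W) {x₀ : M} {m : ℕ}
    {X : Fin m → Π x : M, W x} {c : Fin m → Π z : M, W z →ₗ[ℝ] ℝ} {z : M}
    (hz : z ∈ (chartAt H x₀).source) (hc : ∀ i j, c i z (X j z) = if i = j then 1 else 0)
    (hd : ∀ j v, D.toFun (X j) z v ∈ Submodule.span ℝ (range fun i ↦ X i z)) (j : Fin m) (v : E) :
    D.toFun (X j) z (coordField I x₀ v z) = ∑ i, D.formEntry x₀ X c i j z v • X i z := by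
  simp only [D.formEntry_apply X c _ j hz]
  exact (sum_dual_smul (w := fun i ↦ X i z) (c := fun i ↦ c i z) hc (hd j _)).symm

/-- The connection form in a frame whose curvature vanishes satisfies the Maurer-Cartan equation. -/
lemma Connection.form_flat (D : Connection I F W) {x₀ : M} {m : ℕ}
    {X : Fin m → Π x : M, W x} {c : Fin m → Π z : M, W z →ₗ[ℝ] ℝ} {N : Set M}
    (hN : IsOpen N) (hNs : N ⊆ (chartAt H x₀).source) (hX : ∀ i, IsLocalSection I F (X i) N)
    (hc : ∀ z ∈ N, ∀ i j, c i z (X j z) = if i = j then 1 else 0)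
    (hcs : ∀ Z : Π z : M, W z, IsLocalSection I F Z N → ∀ i,
        ContMDiffOn I 𝓘(ℝ, ℝ) ∞ (fun z ↦ c i z (Z z)) N)
    (hd : ∀ z ∈ N, ∀ j v, D.toFun (X j) z v ∈ Submodule.span ℝ (range fun i ↦ X i z))
    (hcurv : ∀ z ∈ N, ∀ j u v, D.curvature z u v (X j z) = 0) {p : E}
    (hp : p ∈ (extChartAt I x₀).target ∩ (extChartAt I x₀).symm ⁻¹' N) (u v : E) :
    fderiv ℝ (D.form x₀ X c ∘ (extChartAt I x₀).symm) p u v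
      - fderiv ℝ (D.form x₀ X c ∘ (extChartAt I x₀).symm) p v u
      + (((D.form x₀ X c ∘ (extChartAt I x₀).symm) p u).comp
          ((D.form x₀ X c ∘ (extChartAt I x₀).symm) p v)
        - ((D.form x₀ X c ∘ (extChartAt I x₀).symm) p v).comp
          ((D.form x₀ X c ∘ (extChartAt I x₀).symm) p u)) = 0 := by
  classical
  have := FiniteDimensional.complete ℝ E
  set z := (extChartAt I x₀).symm p with hz
  have hzN : z ∈ N := hp.2
  have hpz : extChartAt I x₀ z = p := (extChartAt I x₀).right_inv hp.1
  have hentry (u v : E) (i j : Fin m) :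
      fderiv ℝ (D.form x₀ X c ∘ (extChartAt I x₀).symm) p u v (Pi.single j 1) i =
        mvfderiv I (fun y ↦ D.formEntry x₀ X c i j y v) z (coordField I x₀ u z) := by
    have hsm : ContMDiffOn I 𝓘(ℝ, ℝ) ∞ (fun y ↦ D.formEntry x₀ X c i j y v) N :=
      (D.contMDiffOn_formEntry hN hNs hX hcs i j).clm_apply contMDiffOn_const
    have hform := ((contDiffOn_comp_extChartAt_symm (x₀ := x₀)
      (D.contMDiffOn_form hN hNs hX hcs)).contDiffAt
      ((isOpen_extChartAt_target_inter hN).mem_nhds hp)).differentiableAt (by simp)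
    rw [mvfderiv_coordField hN hzN (hNs hzN) hsm, hpz]
    let L : (E →L[ℝ] (Fin m → ℝ) →L[ℝ] (Fin m → ℝ)) →L[ℝ] ℝ :=
      (ContinuousLinearMap.proj (R := ℝ) (φ := fun _ : Fin m ↦ ℝ) i) ∘L
        (ContinuousLinearMap.apply ℝ (Fin m → ℝ) (Pi.single j 1)) ∘L
        (ContinuousLinearMap.apply ℝ ((Fin m → ℝ) →L[ℝ] (Fin m → ℝ)) v)
    have hL : (fun y ↦ D.formEntry x₀ X c i j y v) ∘ (extChartAt I x₀).symm =
        L ∘ (D.form x₀ X c ∘ (extChartAt I x₀).symm) := by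
      funext q
      simp [L, D.form_apply, Pi.single_apply]
    rw [hL, (L.hasFDerivAt.comp p hform.hasFDerivAt).fderiv]
    rfl
  have hcc (u v : E) (i j : Fin m) :
      c i z (D.deriv (coordField I x₀ u) (D.deriv (coordField I x₀ v) (X j)) z) =
        mvfderiv I (fun y ↦ D.formEntry x₀ X c i j y v) z (coordField I x₀ u z) +
          ∑ k, D.formEntry x₀ X c i k z u * D.formEntry x₀ X c k j z v := by
    have hsm (k) : ContMDiffOn I 𝓘(ℝ, ℝ) ∞ (fun y ↦ D.formEntry x₀ X c k j y v) N :=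
      (D.contMDiffOn_formEntry hN hNs hX hcs k j).clm_apply contMDiffOn_const
    rw [D.deriv_congr hzN _ ((hX j).deriv ((isLocalSection_coordField x₀ v).mono hN hNs))
      (IsLocalSection.sum_smul hN hsm hX)
      fun y hy ↦ D.toFun_frame_eq (hNs hy) (hc y hy) (hd y hy) j v, Connection.deriv,
      D.toFun_sum_smul hN hsm hX hzN]
    simp only [map_sum, map_add, map_smul, Finset.sum_add_distrib, hc z hzN,
      ← D.formEntry_apply X c _ _ (hNs hzN), smul_eq_mul]
    simp [add_comm, mul_comm]
  refine ContinuousLinearMap.coe_injective (LinearMap.pi_ext' fun j ↦ LinearMap.ext_ring ?_)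
  funext i
  have h0 : c i z (D.coordCommutator x₀ u v (X j) z) = 0 := by
    rw [← D.curvature_coordField hNs (hX j) hzN, hcurv z hzN, map_zero]
  rw [Connection.coordCommutator, map_sub, hcc, hcc] at h0
  have hcomp (u v : E) : D.form x₀ X c z u (D.form x₀ X c z v (Pi.single j 1)) i =
      ∑ k, D.formEntry x₀ X c i k z u * D.formEntry x₀ X c k j z v := by
    simp [D.form_apply, Pi.single_apply]
  change fderiv ℝ (D.form x₀ X c ∘ (extChartAt I x₀).symm) p u v (Pi.single j 1) i
    - fderiv ℝ (D.form x₀ X c ∘ (extChartAt I x₀).symm) p v u (Pi.single j 1) i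
    + (D.form x₀ X c z u (D.form x₀ X c z v (Pi.single j 1)) i
      - D.form x₀ X c z v (D.form x₀ X c z u (Pi.single j 1)) i) = 0
  rw [hentry, hentry, hcomp, hcomp]
  linarith

/-- A smooth frame that spans a family of subspaces preserved by `∇` and annihilated by the
curvature can be combined to local parallel sections with prescribed value at a point. -/
theorem Connection.exists_isParallelOn_of_frame (D : Connection I F W) {m : ℕ}
    {X : Fin m → Π x : M, W x} {U : Set M} (hU : IsOpen U) (hX : ∀ i, IsLocalSection I F (X i) U)
    (hli : ∀ y ∈ U, LinearIndependent ℝ fun i ↦ X i y)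
    (hd : ∀ y ∈ U, ∀ j v, D.toFun (X j) y v ∈ Submodule.span ℝ (range fun i ↦ X i y))
    (hcurv : ∀ y ∈ U, ∀ j u v, D.curvature y u v (X j y) = 0) {x : M} (hx : x ∈ U) {w : W x}
    (hw : w ∈ Submodule.span ℝ (range fun i ↦ X i x)) :
    ∃ (U' : Set M) (Y : Π x : M, W x), x ∈ U' ∧ U' ⊆ U ∧ D.IsParallelOn Y U' ∧
      (∀ y ∈ U', Y y ∈ Submodule.span ℝ (range fun i ↦ X i y)) ∧ Y x = w := by
  obtain ⟨U₁, hU₁U, hU₁, hxU₁, c, hc, hcs⟩ := exists_dualFrame hU hX hx (hli x hx)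
  let N := U₁ ∩ (chartAt H x).source
  have hN : IsOpen N := hU₁.inter (chartAt H x).open_source
  have hNs : N ⊆ (chartAt H x).source := inter_subset_right
  have hxN : x ∈ N := ⟨hxU₁, mem_chart_source H x⟩
  have hNU : N ⊆ U := inter_subset_left.trans hU₁U
  have hXN (i) := (hX i).mono hN hNU
  have hcN (z) (hz : z ∈ N) := hc z hz.1
  have hcsN (Z : Π z : M, W z) (hZ : IsLocalSection I F Z N) (i : Fin m) :
      ContMDiffOn I 𝓘(ℝ, ℝ) ∞ (fun z ↦ c i z (Z z)) N :=
    (hcs Z N hZ i).mono fun z hz ↦ ⟨hz.1, hz⟩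
  have hsrc (z) (hz : z ∈ N) : z ∈ (extChartAt I x).source := by
    simpa [extChartAt_source] using hNs hz
  have hmem (z) (hz : z ∈ N) :
      extChartAt I x z ∈ (extChartAt I x).target ∩ (extChartAt I x).symm ⁻¹' N :=
    ⟨(extChartAt I x).map_source (hsrc z hz), by
      rwa [mem_preimage, (extChartAt I x).left_inv (hsrc z hz)]⟩
  obtain ⟨r, hr, -, hsol⟩ := exists_solution_of_flat (isOpen_extChartAt_target_inter hN)
    (contDiffOn_comp_extChartAt_symm (D.contMDiffOn_form hN hNs hXN hcsN))
    (fun p hp u v ↦ D.form_flat hN hNs hXN hcN hcsN (fun z hz ↦ hd z (hNU hz))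
      (fun z hz ↦ hcurv z (hNU hz)) hp u v) (hmem x hxN)
  obtain ⟨f, hf0, hfs, hfd⟩ := hsol fun i ↦ c i x w
  let U' := N ∩ extChartAt I x ⁻¹' Metric.ball (extChartAt I x x) r
  have hchart : ContMDiffOn I 𝓘(ℝ, E) ∞ (extChartAt I x) N := contMDiffOn_extChartAt.mono hNs
  have hU' : IsOpen U' := hchart.continuousOn.isOpen_inter_preimage hN Metric.isOpen_ball
  have hxU' : x ∈ U' := ⟨hxN, Metric.mem_ball_self hr⟩
  have hfi (i : Fin m) : ContMDiffOn I 𝓘(ℝ, ℝ) ∞ (fun z ↦ f (extChartAt I x z) i) U' :=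
    (contDiffOn_pi.1 hfs i).contMDiffOn.comp (hchart.mono inter_subset_left) fun z hz ↦ hz.2
  have hXU' (i) := (hXN i).mono hU' inter_subset_left
  refine ⟨U', fun z ↦ ∑ i, f (extChartAt I x z) i • X i z, hxU', inter_subset_left.trans hNU,
    ⟨IsLocalSection.sum_smul hU' hfi hXU', fun y hy ↦ ?_⟩, fun y _ ↦ ?_, ?_⟩
  · ext v
    obtain ⟨v, rfl⟩ := exists_coordField_eq (hNs hy.1) v
    have hder (i : Fin m) : mvfderiv I (fun z ↦ f (extChartAt I x z) i) y (coordField I x v y) =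
        -∑ j, D.formEntry x X c i j y v * f (extChartAt I x y) j := by
      have h1 := hasFDerivAt_pi'.1 (hfd _ hy.2) i
      rw [mvfderiv_comp_extChartAt_coordField (Q := fun q ↦ f q i) (hNs hy.1)
        h1.differentiableAt, h1.fderiv, ← D.form_apply]
      change -D.form x X c ((extChartAt I x).symm (extChartAt I x y)) v _ i = _
      rw [(extChartAt I x).left_inv (hsrc y hy.1)]
    rw [D.toFun_sum_smul hU' hfi hXU' hy]
    simp only [hder, D.toFun_frame_eq (hNs hy.1) (hcN y hy.1) (hd y (hNU hy.1)),
      Finset.sum_add_distrib, Finset.smul_sum, neg_smul, Finset.sum_neg_distrib, Finset.sum_smul]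
    rw [Finset.sum_comm]
    simp [smul_smul, mul_comm]
  · exact Submodule.sum_mem _ fun i _ ↦
      Submodule.smul_mem _ _ (Submodule.subset_span (mem_range_self i))
  · simp only [hf0]
    exact sum_dual_smul (w := fun i ↦ X i x) (c := fun i ↦ c i x) (hc x hxU₁) hw

/-- At a regular point every vector of the terminal subset extends to a local parallel section. -/
theorem Connection.IsRegularAt.exists_isParallelOn {D : Connection I F W} {x : M}
    (h : D.IsRegularAt x) {w : W x} (hw : w ∈ D.terminal x) :
    ∃ (U : Set M) (X : Π x : M, W x), x ∈ U ∧ D.IsParallelOn X U ∧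
      TakesValuesIn D.terminal X U ∧ X x = w := by
  obtain ⟨U₀, hxU₀, -, hsub⟩ := h
  obtain ⟨n, U, X, hxU, hX, hspan⟩ := hsub x hxU₀
  rcases n.eq_zero_or_pos with rfl | hn
  · have hw0 : w = 0 := by
      rw [← (hspan x hxU).2] at hw
      simpa using hw
    exact ⟨univ, 0, mem_univ x, ⟨⟨isOpen_univ, (contMDiff_zeroSection ℝ W).contMDiffOn⟩,
      fun y _ ↦ by simp [D.isCovariantDerivativeOnUniv.zero]⟩, fun y _ ↦ (D.terminal y).zero_mem,
      hw0.symm⟩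
  have hXV (i) : TakesValuesIn D.terminal (X i) U := fun y hy ↦ by
    rw [← (hspan y hy).2]
    exact Submodule.subset_span (mem_range_self i)
  obtain ⟨U', Y, hxU', hU'U, hY, hYs, hYx⟩ := D.exists_isParallelOn_of_frame
    (hX ⟨0, hn⟩).isOpen hX (fun y hy ↦ (hspan y hy).1)
    (fun y hy j v ↦ by
      rw [(hspan y hy).2]
      exact D.toFun_mem_terminal (hX j) (hXV j) hy v)
    (fun y hy j u v ↦ D.curvature_eq_zero_of_mem_terminal (hXV j y hy) u v) hxU
    (by rwa [(hspan x hxU).2])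
  exact ⟨U', Y, hxU', hY, fun y hy ↦ by
    rw [← (hspan y (hU'U hy)).2]
    exact hYs y hy, hYx⟩

/-- Near a regular point there are as many independent parallel sections as the dimension of the
terminal subset. -/
theorem Connection.IsRegularAt.exists_parallelFrame {D : Connection I F W} {x : M}
    (h : D.IsRegularAt x) :
    ∃ (U : Set M) (X : Fin (Module.finrank ℝ (D.terminal x)) → Π x : M, W x),
      x ∈ U ∧ (∀ i, D.IsParallelOn (X i) U) ∧
      ∀ y ∈ U, LinearIndependent ℝ (fun i ↦ X i y) := by
  have := VectorBundle.finiteDimensional ℝ F W x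
  let b := Module.finBasis ℝ (D.terminal x)
  choose U X hxU hX _ hXb using fun i ↦ h.exists_isParallelOn (b i).2
  have hN : IsOpen (⋂ i, U i) := isOpen_iInter_of_finite fun i ↦ (hX i).1.isOpen
  have hli : LinearIndependent ℝ fun i ↦ X i x := by
    simp only [hXb]
    exact b.linearIndependent.map' (D.terminal x).subtype (Submodule.ker_subtype _)
  obtain ⟨U', hU', hU'o, hxU', c, hc, -⟩ := exists_dualFrame hN
    (fun i ↦ (hX i).1.mono hN (iInter_subset U i)) (mem_iInter.2 hxU) hli
  exact ⟨U', X, hxU', fun i ↦ (hX i).mono hU'o (hU'.trans (iInter_subset U i)),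
    fun y hy ↦ linearIndependent_of_dual (c := fun i ↦ c i y) (hc y hy)⟩

theorem Connection.IsRegular.isFlatSubbundle {D : Connection I F W} (h : D.IsRegular) :
    D.IsFlatSubbundle D.terminal where
  isSubbundle := h
  deriv_mem _ _ hX hXV _ hy v := D.toFun_mem_terminal hX hXV hy v
  curvature_eq_zero _ u v _ hw := D.curvature_eq_zero_of_mem_terminal hw u v

end ParallelSections

section PositiveDefinite

lemma pos_of_pos_on_sphere {E : Type*} [NormedAddCommGroup E] [NormedSpace ℝ E]
    {B : E →L[ℝ] E →L[ℝ] ℝ} (h : ∀ u ∈ Metric.sphere (0 : E) 1, 0 < B u u) {v : E} (hv : v ≠ 0) :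
    0 < B v v := by
  have hn : 0 < ‖v‖ := norm_pos_iff.2 hv
  have h1 := h (‖v‖⁻¹ • v) (by simp [norm_smul, hn.ne'])
  simp only [map_smul, _root_.smul_apply, smul_eq_mul] at h1
  exact pos_of_mul_pos_right (pos_of_mul_pos_right h1 (by positivity)) (by positivity)

lemma eventually_posDef {E : Type*} [NormedAddCommGroup E] [NormedSpace ℝ E]
    [FiniteDimensional ℝ E] {B₀ : E →L[ℝ] E →L[ℝ] ℝ} (h : ∀ v ≠ 0, 0 < B₀ v v) :
    ∀ᶠ B in 𝓝 B₀, ∀ v ≠ 0, 0 < B v v := by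
  have := FiniteDimensional.proper_real E
  have hcont : Continuous fun q : (E →L[ℝ] E →L[ℝ] ℝ) × E ↦ q.1 q.2 q.2 :=
    (continuous_fst.clm_apply continuous_snd).clm_apply continuous_snd
  have hev : ∀ᶠ B in 𝓝 B₀, ∀ v ∈ Metric.sphere (0 : E) 1, 0 < B v v :=
    (isCompact_sphere (0 : E) 1).eventually_forall_of_forall_eventually fun v hv ↦
      hcont.continuousAt.eventually_const_lt (h v (Metric.ne_of_mem_sphere hv one_ne_zero))
  filter_upwards [hev] with B hB v hv using pos_of_pos_on_sphere hB hv

variable {E : Type*} [NormedAddCommGroup E] [NormedSpace ℝ E] [FiniteDimensional ℝ E]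
  {H : Type*} [TopologicalSpace H] {I : ModelWithCorners ℝ E H}
  {M : Type*} [TopologicalSpace M] [ChartedSpace H M] [IsManifold I ∞ M]

/-- A symmetric tensor field that is positive definite at a point is so near that point. -/
lemma IsLocalSection.eventually_isPosDef {g : Π x : M, SymBundle I x} {U : Set M} {x : M}
    (hg : IsLocalSection I (SymForm E) g U) (hx : x ∈ U) (hpos : (g x).IsPosDef) :
    ∀ᶠ y in 𝓝 x, (g y).IsPosDef := by
  let e := trivializationAt E (TangentSpace I : M → Type _) x
  let G (y : M) : E →L[ℝ] E →L[ℝ] ℝ :=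
    SymForm.toCLM E (trivializationAt (SymForm E) (SymBundle I) x ⟨y, g y⟩).2
  have hGc : ContinuousAt G x :=
    (SymForm.toCLM E).continuous.continuousAt.comp
      ((hg.contMDiffOn_trivializationAt x).continuousOn.continuousAt
        ((hg.isOpen.inter (Trivialization.open_baseSet _)).mem_nhds
          ⟨hx, mem_baseSet_trivializationAt' x⟩))
  have hG {y : M} (hy : y ∈ (chartAt H x).source) (v : TangentSpace I y) :
      (g y).toBilin v v = G y (e ⟨y, v⟩).2 (e ⟨y, v⟩).2 := SymBundle.toBilin_eq hy _ _ _
  have hGx : ∀ v ≠ 0, 0 < G x v v := by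
    intro v hv
    let L := e.continuousLinearEquivAt ℝ x (mem_baseSet_trivializationAt' x)
    have hL : (e ⟨x, L.symm v⟩).2 = v := L.apply_symm_apply v
    have h1 := hpos (L.symm v) (L.symm.map_eq_zero_iff.not.2 hv)
    rwa [hG (mem_chart_source H x), hL] at h1
  filter_upwards [hGc.eventually (eventually_posDef hGx),
    (chartAt H x).open_source.mem_nhds (mem_chart_source H x)] with y hy hys v hv
  rw [hG hys]
  refine hy _ fun h0 ↦ hv ?_
  exact (e.continuousLinearEquivAt ℝ y hys).map_eq_zero_iff.1 h0

/-- A connection whose induced connection on symmetric two-tensors is regular at `x` is locally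
metric at `x` if and only if the terminal subset contains a positive definite form at `x`. -/
theorem Connection.isLocallyMetricAt_iff [I.Boundaryless]
    (C : Connection I E (TangentSpace I : M → Type _)) {x : M} (h : C.onSymForms.IsRegularAt x) :
    C.IsLocallyMetricAt x ↔ ∃ g ∈ C.onSymForms.terminal x, SymBundle.IsPosDef g := by
  constructor
  · rintro ⟨U, g, hx, hg, hpos⟩
    exact ⟨g x, hg.takesValuesIn_terminal x hx, hpos x hx⟩
  · rintro ⟨g₀, hg₀, hpos⟩
    obtain ⟨U, g, hx, hg, -, rfl⟩ := h.exists_isParallelOn hg₀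
    obtain ⟨U', hU', hU'o, hxU'⟩ := mem_nhds_iff.1 (hg.1.eventually_isPosDef hx hpos)
    exact ⟨U ∩ U', g, ⟨hx, hxU'⟩, hg.mono (hg.1.isOpen.inter hU'o) inter_subset_left,
      fun y hy ↦ hU' hy.2⟩

end PositiveDefinite

end DerivedFlag

end

/-- Local parallel sections take values in the terminal subset `W̃` of the derived flag; at a
regular point every vector of `W̃` extends to a local parallel section with values in `W̃`; the
consequences on flatness, on the number of local parallel sections and on locally metric
connections. -/
theorem theorem1
    {E : Type*} [NormedAddCommGroup E] [NormedSpace ℝ E] [FiniteDimensional ℝ E]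
    {H : Type*} [TopologicalSpace H] (I : ModelWithCorners ℝ E H) [I.Boundaryless]
    {M : Type*} [TopologicalSpace M] [ChartedSpace H M] [IsManifold I ∞ M]
    (F : Type*) [NormedAddCommGroup F] [NormedSpace ℝ F] [FiniteDimensional ℝ F]
    (W : M → Type*) [TopologicalSpace (TotalSpace F W)]
    [∀ x, AddCommGroup (W x)] [∀ x, Module ℝ (W x)] [∀ x, TopologicalSpace (W x)]
    [∀ x, IsTopologicalAddGroup (W x)] [∀ x, ContinuousSMul ℝ (W x)]
    [FiberBundle F W] [VectorBundle ℝ F W] [ContMDiffVectorBundle ∞ F W I]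
    (D : DerivedFlag.Connection I F W) :
    -- the derived flag descends and terminates at `W̃`
    ((∀ i x, D.derivedFlag (i + 1) x ≤ D.derivedFlag i x) ∧
      ∃ k, ∀ l, k ≤ l → D.derivedFlag l = D.terminal) ∧
    -- (i) local parallel sections take values in `W̃`
    (∀ (U : Set M) (X : Π x : M, W x), D.IsParallelOn X U →
      DerivedFlag.TakesValuesIn D.terminal X U) ∧
    -- (ii) existence of local parallel sections at a regular point
    (∀ x, D.IsRegularAt x → ∀ w ∈ D.terminal x, ∃ (U : Set M) (X : Π x : M, W x),
      x ∈ U ∧ D.IsParallelOn X U ∧ DerivedFlag.TakesValuesIn D.terminal X U ∧ X x = w) ∧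
    -- if the connection is regular, `(W̃, ∇)` is a flat vector bundle over `M`
    (D.IsRegular → D.IsFlatSubbundle D.terminal) ∧
    -- `dim W̃_x` independent local parallel sections near a regular point
    (∀ x, D.IsRegularAt x → ∃ (U : Set M)
      (X : Fin (Module.finrank ℝ (D.terminal x)) → Π x : M, W x),
      x ∈ U ∧ (∀ i, D.IsParallelOn (X i) U) ∧
      ∀ y ∈ U, LinearIndependent ℝ (fun i ↦ X i y)) ∧
    -- for a connection on `M`, acting on symmetric covariant two-tensors and regular at `x`:
    -- it is locally metric at `x` iff `W̃_x` contains a positive-definite bilinear form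
    (∀ (C : DerivedFlag.Connection I E (TangentSpace I : M → Type _)) (x : M),
      C.onSymForms.IsRegularAt x →
        (C.IsLocallyMetricAt x ↔
          ∃ g ∈ C.onSymForms.terminal x, DerivedFlag.SymBundle.IsPosDef g)) := by
  exact ⟨⟨D.derivedFlag_succ_le, Module.finrank ℝ F, fun _ hl ↦ D.derivedFlag_eq_terminal hl⟩,
    fun _ _ hX ↦ hX.takesValuesIn_terminal, fun _ hx _ hw ↦ hx.exists_isParallelOn hw,
    fun h ↦ h.isFlatSubbundle, fun _ hx ↦ hx.exists_parallelFrame,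
    fun C _ hx ↦ C.isLocallyMetricAt_iff hx⟩
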